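/- Let $(\xi,J)$ be a nondecreasing Markov additive process (MAP) with types in $[K]=\{1,\dots,K\}$: a process with values in $([0,\infty)\times[K])\cup\{(+\infty,0)\}$, the point $(+\infty,0)$ being an absorbing cemetery state, such that $\xi$ is nondecreasing and, under the law $\mathbb P_i$ for which it starts at $(0,i)$, for every $t\ge 0$, conditionally on the past up to time $t$ and on $\xi_t<\infty$, the process $(\xi_{t+s}-\xi_t,J_{t+s})_{s\ge0}$ has law $\mathbb P_{J_t}$. Let its characteristics be: the transition rate matrix $\mathbf\Lambda=(\lambda_{i,j})$ of the types (with zero row sums); probability measures $B_{i,j}$ on $[0,\infty)$, the laws of the jump of $\xi$ when the type changes from $i$ to $j$ (with $B_{i,i}=\delta_0$); and, for each type $i$, the killing rate $k^{(i)}\ge0$, the drift $c^{(i)}\ge0$ and the Lévy measure $\Pi^{(i)}$ on $(0,\infty)$, $\int(1\wedge x)\,\Pi^{(i)}(\mathrm dx)<\infty$, of the subordinator that $\xi$ follows while the type is $i$. For $p\ge 0$ let $$\psi_i(p)=k^{(i)}+c^{(i)}p+\int_{(0,\infty)}(1-e^{-px})\,\Pi^{(i)}(\mathrm dx),\qquad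 \mathbf\Phi(p)_{i,j}=\psi_i(p)\mathbf 1_{\{i=j\}}-\lambda_{i,j}\int_{[0,\infty)}e^{-px}B_{i,j}(\mathrm dx)$$ be the Laplace exponents and the Bernstein matrix. Assume that $\mathbf\Lambda$ is irreducible and that the position is not a.s. constant: some $\psi_i$ is not identically $0$, or $B_{i,j}((0,\infty))>0$ for some $i,j$ with $\lambda_{i,j}>0$. Let $I_\xi=\int_0^\infty e^{-\xi_t}\,\mathrm dt$ (with $e^{-\infty}=0$), and let $\mathbf 1$ be the column vector with all entries $1$. Then $\mathbf\Phi(p)$ is invertible for all $p>0$, and: (i) For every integer $k\ge0$, the vector $\mathbf N(k)=(\mathbb E_i[I_\xi^k])_{i\in[K]}$ has finite entries and $$\mathbf N(k)=k!\,\Big(\prod_{l=0}^{k-1}\mathbf\Phi(k-l)^{-1}\Big)\mathbf 1=k!\,\mathbf\Phi(k)^{-1}\mathbf\Phi(k-1)^{-1}\cdots\mathbf\Phi(1)^{-1}\,\mathbf 1 .$$ (ii) The limit $\mathbf L=\lim_{k\to\infty}\mathbf\Phi(k)^{-1}$ exists, and, $\rho(\mathbf L)$ being its spectral radius, for every real $a<1/\rho(\mathbf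 L)$ (with $1/0=+\infty$) we have $\mathbb E_i[e^{aI_\xi}]<\infty$ for every $i\in[K]$. -/

import Mathlib

open MeasureTheory Filter Topology Set
open scoped NNReal ENNReal

noncomputable section

namespace MAP

/-- The set of states of the type component, `none` being the cemetery, is discrete. -/
instance instMeasurableSpaceOptionFin (K : ℕ) : MeasurableSpace (Option (Fin K)) := ⊤

/-- The characteristics of a nondecreasing Markov additive process with `K` types:
the transition rate matrix `rate` of the types, the laws `jump i j` (on `[0, ∞)`) of the jump of
the position at a change of type from `i` to `j`, and, for every type `i`, the killing rate, the
drift and the Lévy measure (on `(0, ∞)`) of the subordinator followed while the type is `i`. -/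
structure Characteristics (K : ℕ) where
  rate : Matrix (Fin K) (Fin K) ℝ
  jump : Fin K → Fin K → Measure ℝ
  kill : Fin K → ℝ
  drift : Fin K → ℝ
  levy : Fin K → Measure ℝ
  rate_nonneg : ∀ i j, i ≠ j → 0 ≤ rate i j
  rate_sum : ∀ i, ∑ j, rate i j = 0
  jump_prob : ∀ i j, IsProbabilityMeasure (jump i j)
  jump_supp : ∀ i j, jump i j (Iio 0) = 0
  jump_self : ∀ i, jump i i = Measure.dirac 0
  kill_nonneg : ∀ i, 0 ≤ kill i
  drift_nonneg : ∀ i, 0 ≤ drift i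
  levy_supp : ∀ i, levy i (Iic 0) = 0
  levy_finite : ∀ i, ∫⁻ x, ENNReal.ofReal (min 1 x) ∂(levy i) < ∞

namespace Characteristics

variable {K : ℕ}

/-- The Laplace exponent `ψ_i(p) = k_i + c_i p + ∫ (1 - e^{-px}) Π_i(dx)`. -/
def psi (χ : Characteristics K) (i : Fin K) (p : ℝ) : ℝ :=
  χ.kill i + χ.drift i * p + ∫ x in Ioi 0, (1 - Real.exp (-(p * x))) ∂(χ.levy i)

/-- The Laplace transform `∫ e^{-px} B_{i,j}(dx)` of the law of a jump. -/
def jumpLaplace (χ : Characteristics K) (p : ℝ) : Matrix (Fin K) (Fin K) ℝ :=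
  Matrix.of fun i j => ∫ x in Ici 0, Real.exp (-(p * x)) ∂(χ.jump i j)

/-- The Bernstein matrix `Φ(p) = diag(ψ_i(p)) - Λ ∘ B̂(p)` (entrywise product), for `p ≥ 0`. -/
def bernstein (χ : Characteristics K) (p : ℝ) : Matrix (Fin K) (Fin K) ℝ :=
  Matrix.diagonal (fun i => χ.psi i p) - Matrix.hadamard χ.rate (χ.jumpLaplace p)

/-- The chain of types is irreducible: any two types are joined by a (possibly trivial) chain of
transitions with positive rates. -/
def IsIrreducible (χ : Characteristics K) : Prop :=
  ∀ i j, Relation.ReflTransGen (fun a b => 0 < χ.rate a b) i j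

/-- The position is not almost surely constant: one of the Laplace exponents is not identically
zero, or a jump that accompanies some possible change of type can be positive. -/
def PositionNonconstant (χ : Characteristics K) : Prop :=
  (∃ i, ∃ p : ℝ, 0 ≤ p ∧ χ.psi i p ≠ 0) ∨
    ∃ i j, 0 < χ.rate i j ∧ 0 < χ.jump i j (Ioi 0)

/-- The infinitesimal generator at the point `(0, i)`, applied to a function `f` of the type and
of the position (and with value zero at the cemetery). -/
def generator (χ : Characteristics K) (f : Fin K → ℝ → ℝ) (i : Fin K) : ℝ :=
  - χ.kill i * f i 0 + χ.drift i * deriv (f i) 0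
    + (∫ x in Ioi 0, (f i x - f i 0) ∂(χ.levy i))
    + ∑ j, χ.rate i j * ∫ x in Ici 0, f j x ∂(χ.jump i j)

end Characteristics

variable {K : ℕ} {Ω : Type*}

/-- The information on the process up to time `t`. -/
abbrev past (ξ : ℝ≥0 → Ω → ℝ≥0∞) (J : ℝ≥0 → Ω → Option (Fin K)) (t : ℝ≥0) : MeasurableSpace Ω :=
  ⨆ u ≤ t, MeasurableSpace.comap (fun ω => (ξ u ω, J u ω)) inferInstance

/-- The path of the process. -/
def path (ξ : ℝ≥0 → Ω → ℝ≥0∞) (J : ℝ≥0 → Ω → Option (Fin K)) (ω : Ω) :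
    ℝ≥0 → ℝ≥0∞ × Option (Fin K) :=
  fun s => (ξ s ω, J s ω)

/-- The path of the process `(ξ_{t+s} - ξ_t, J_{t+s})_{s ≥ 0}`. It is used only where `ξ_t < ∞`,
so that, `ξ` being nondecreasing, the truncated difference is the true one. -/
def shiftedPath (ξ : ℝ≥0 → Ω → ℝ≥0∞) (J : ℝ≥0 → Ω → Option (Fin K)) (t : ℝ≥0) (ω : Ω) :
    ℝ≥0 → ℝ≥0∞ × Option (Fin K) :=
  fun s => (ξ (t + s) ω - ξ t ω, J (t + s) ω)

/-- `(ξ, J)` is a nondecreasing Markov additive process, `P i` being the law under which it starts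
at `(0, i)`. The cemetery is `(∞, none)`; it is absorbing because `ξ` is nondecreasing.
By additivity, the law of the process started at `(x, i)` is that of `(x + ξ, J)` under `P i`.
No regularity in time of the paths is asked for beyond monotonicity. -/
structure IsNondecreasingMAP [MeasurableSpace Ω] (P : Fin K → Measure Ω)
    (ξ : ℝ≥0 → Ω → ℝ≥0∞) (J : ℝ≥0 → Ω → Option (Fin K)) : Prop where
  prob : ∀ i, IsProbabilityMeasure (P i)
  measurable_position : ∀ t, Measurable (ξ t)
  measurable_type : ∀ t, Measurable (J t)
  monotone : ∀ ω, Monotone fun t => ξ t ω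
  dead_iff : ∀ t ω, ξ t ω = ∞ ↔ J t ω = none
  start : ∀ i, ∀ᵐ ω ∂(P i), ξ 0 ω = 0 ∧ J 0 ω = some i
  /-- Given the past up to `t`, on the event that the process is alive with type `j` at time `t`,
  the process `(ξ_{t+s} - ξ_t, J_{t+s})_{s ≥ 0}` has the law of `(ξ, J)` under `P j`. -/
  markov_additive : ∀ (i j : Fin K) (t : ℝ≥0) (A : Set Ω), MeasurableSet[past ξ J t] A →
    ∀ C : Set (ℝ≥0 → ℝ≥0∞ × Option (Fin K)), MeasurableSet C →
      P i (A ∩ {ω | J t ω = some j} ∩ {ω | shiftedPath ξ J t ω ∈ C})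
        = P i (A ∩ {ω | J t ω = some j}) * P j {ω | path ξ J ω ∈ C}

/-- Test functions: for each type, a function of class `C¹` of the position, bounded on `[0, ∞)`
together with its derivative. -/
def IsTestFunction (f : Fin K → ℝ → ℝ) : Prop :=
  ∀ j, ContDiff ℝ 1 (f j) ∧ ∃ C : ℝ, ∀ x, 0 ≤ x → |f j x| ≤ C ∧ |deriv (f j) x| ≤ C

/-- `E_i[f(J_t, ξ_t), t < death time]`. -/
def semigroup [MeasurableSpace Ω] (P : Fin K → Measure Ω)
    (ξ : ℝ≥0 → Ω → ℝ≥0∞) (J : ℝ≥0 → Ω → Option (Fin K)) (f : Fin K → ℝ → ℝ) (t : ℝ≥0)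
    (i : Fin K) : ℝ :=
  ∑ j, ∫ ω in {ω | J t ω = some j}, f j (ξ t ω).toReal ∂(P i)

/-- The process has the characteristics `χ`: its generator is the one that `χ` prescribes (killing
at rate `k_i`, drift `c_i` and jumps of intensity `Π_i` while the type is `i`, changes of type from
`i` to `j` at rate `λ_{i,j}`, accompanied by a jump with law `B_{i,j}`). -/
def HasCharacteristics [MeasurableSpace Ω] (P : Fin K → Measure Ω)
    (ξ : ℝ≥0 → Ω → ℝ≥0∞) (J : ℝ≥0 → Ω → Option (Fin K)) (χ : Characteristics K) : Prop :=
  ∀ f : Fin K → ℝ → ℝ, IsTestFunction f → ∀ i,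
    Tendsto (fun t : ℝ≥0 => (semigroup P ξ J f t i - f i 0) / (t : ℝ)) (𝓝[>] 0)
      (𝓝 (χ.generator f i))

/-- The exponential functional `I_ξ = ∫_0^∞ e^{-ξ_t} dt`, where `e^{-∞} = 0`. -/
def expFunctional (ξ : ℝ≥0 → Ω → ℝ≥0∞) (ω : Ω) : ℝ≥0∞ :=
  ∫⁻ t in Ici (0 : ℝ), EReal.exp (-(ξ t.toNNReal ω : EReal))

/-- The moment vector `N(k)`, with entries `E_i[I_ξ^k]`. -/
def moment [MeasurableSpace Ω] (P : Fin K → Measure Ω) (ξ : ℝ≥0 → Ω → ℝ≥0∞) (k : ℕ)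
    (i : Fin K) : ℝ≥0∞ :=
  ∫⁻ ω, expFunctional ξ ω ^ k ∂(P i)

/-- The ordered product `Φ(k)⁻¹ Φ(k-1)⁻¹ ⋯ Φ(1)⁻¹`. -/
def bernsteinProd (χ : Characteristics K) (k : ℕ) : Matrix (Fin K) (Fin K) ℝ :=
  ((List.range k).map fun l => (χ.bernstein ((k : ℝ) - (l : ℝ)))⁻¹).prod

end MAP

end

/-! Let `M_t` be the matrix with entries `E_i[e^{-kξ_t}, J_t = j]`. Differentiating the tail `∫_t^∞
e^{-ξ_s} ds` raised to the power `k+1` gives `I^{k+1} = (k+1) ∫_0^∞ e^{-ξ_t} (∫_t^∞ e^{-ξ_s} ds)^k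
dt`. The tail is `e^{-ξ_t}` times the exponential functional of the shifted process, so the Markov
additive property yields `N(k+1) = (k+1) (∫_0^∞ M_t dt) N(k)`, with `M_t` taken at exponent `k+1`
(`moment_succ`).

The `M_t` form a semigroup whose right derivative at `0` is `-Φ(k)`: this is the generator on
exponentials. Hence `M' = -MΦ(k)` and `∫_0^T M_t dt = (1 - M_T) Φ(k)⁻¹`. For `k ≥ 1` the row sums of
`M_T` decrease to `0`, so the potential `∫_0^∞ M_t dt` is `Φ(k)⁻¹` (`setLIntegral_laplace`), and (i)
follows by induction. Invertibility of `Φ(p)` is a maximum principle: the matrix is weakly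
diagonally dominant, and irreducibility spreads the equality case to all types, where nonconstancy
of the position contradicts it.

Being potentials, the `Φ(k)⁻¹` are nonnegative and entrywise decreasing in `k ≥ 1`, so `L` exists.
Also `N(k+n)/(k+n)! ≤ Φ(k)⁻ⁿ N(k)/k!` entrywise. If `a < 1/ρ(L)` with `a > 0`, upper semicontinuity
of the spectral radius gives `ρ(aΦ(k)⁻¹) < 1` for some `k`, and the exponential series of the
moments converges.

Paths are monotone but otherwise irregular, so joint measurability in time and chance is replaced
throughout by dyadic approximation. -/

noncomputable section

/-! ### Tonelli for processes with monotone paths -/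

namespace MAP

/-- The least multiple of `2⁻ⁿ` strictly above `t`. -/
def dyadicAbove (n : ℕ) (t : ℝ) : ℝ := ((⌊t * 2 ^ n⌋ : ℝ) + 1) / 2 ^ n

lemma lt_dyadicAbove (n : ℕ) (t : ℝ) : t < dyadicAbove n t := by
  rw [dyadicAbove, lt_div_iff₀ (by positivity)]
  exact Int.lt_floor_add_one _

lemma dyadicAbove_le (n : ℕ) (t : ℝ) : dyadicAbove n t ≤ t + (1 / 2) ^ n := by
  rw [dyadicAbove, div_le_iff₀ (by positivity), add_mul, ← mul_pow]
  norm_num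
  exact Int.floor_le _

lemma antitone_dyadicAbove (t : ℝ) : Antitone fun n => dyadicAbove n t := by
  refine antitone_nat_of_succ_le fun n => ?_
  simp only [dyadicAbove]
  rw [div_le_div_iff₀ (by positivity) (by positivity), pow_succ]
  have h : ⌊t * (2 ^ n * 2)⌋ + 1 ≤ (⌊t * 2 ^ n⌋ + 1) * 2 := by
    have : ⌊t * (2 ^ n * 2)⌋ < (⌊t * 2 ^ n⌋ + 1) * 2 := by
      rw [Int.floor_lt]
      push_cast
      have := Int.lt_floor_add_one (t * 2 ^ n)
      linarith
    omega
  have h' : ((⌊t * (2 ^ n * 2)⌋ : ℝ) + 1) ≤ (⌊t * 2 ^ n⌋ + 1) * 2 := by exact_mod_cast h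
  have h2 : (0 : ℝ) < 2 ^ n := by positivity
  nlinarith

lemma tendsto_dyadicAbove (t : ℝ) : Tendsto (fun n => dyadicAbove n t) atTop (𝓝 t) := by
  have h : Tendsto (fun n : ℕ => t + (1 / 2 : ℝ) ^ n) atTop (𝓝 (t + 0)) :=
    tendsto_const_nhds.add (tendsto_pow_atTop_nhds_zero_of_lt_one (by norm_num) (by norm_num))
  rw [add_zero] at h
  exact tendsto_of_tendsto_of_tendsto_of_le_of_le tendsto_const_nhds h
    (fun n => (lt_dyadicAbove n t).le) (fun n => dyadicAbove_le n t)

/-- A monotone function has countably many discontinuities; elsewhere the values along the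
decreasing dyadics increase to the value at `t`. -/
lemma ae_iSup_dyadicAbove {g : ℝ → ℝ≥0∞} (hg : Antitone g) :
    ∀ᵐ t, ⨆ n, g (dyadicAbove n t) = g t := by
  filter_upwards [hg.countable_not_continuousAt.ae_notMem volume] with t ht
  have hc : ContinuousAt g t := by simpa using ht
  exact tendsto_nhds_unique
    (tendsto_atTop_iSup fun m n h => hg (antitone_dyadicAbove t h))
    (hc.tendsto.comp (tendsto_dyadicAbove t))

variable {α : Type*} [MeasurableSpace α]

/-- Each approximation sees `t` only through the integer `⌊t 2ⁿ⌋`, so measurability at fixed times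
is enough. -/
lemma measurable_iSup_dyadicAbove {g : ℝ → α → ℝ≥0∞} (hm : ∀ t, Measurable (g t)) :
    Measurable fun x : ℝ × α => ⨆ n, g (dyadicAbove n x.1) x.2 := by
  refine Measurable.iSup fun n => ?_
  have h : Measurable fun y : ℤ × α => g (((y.1 : ℝ) + 1) / 2 ^ n) y.2 :=
    measurable_from_prod_countable_right fun m => hm (((m : ℝ) + 1) / 2 ^ n)
  exact h.comp (((measurable_fst.mul_const _).floor).prodMk measurable_snd)

lemma measurable_setLIntegral_iSup_dyadicAbove {g : ℝ → α → ℝ≥0∞} (hm : ∀ t, Measurable (g t))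
    (s : Set ℝ) : Measurable fun x => ∫⁻ t in s, ⨆ n, g (dyadicAbove n t) x :=
  (measurable_iSup_dyadicAbove hm).lintegral_prod_left'

lemma measurable_setLIntegral_of_antitone {g : ℝ → α → ℝ≥0∞} (hm : ∀ t, Measurable (g t))
    (ha : ∀ x, Antitone fun t => g t x) (s : Set ℝ) :
    Measurable fun x => ∫⁻ t in s, g t x := by
  have h : (fun x => ∫⁻ t in s, g t x) = fun x => ∫⁻ t in s, ⨆ n, g (dyadicAbove n t) x := by
    ext x
    exact lintegral_congr_ae (ae_restrict_of_ae ((ae_iSup_dyadicAbove (ha x)).mono fun _ h => h.symm))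
  rw [h]
  exact measurable_setLIntegral_iSup_dyadicAbove hm s

/-- Tonelli's theorem for a process with monotone paths, which need not be jointly measurable. -/
lemma lintegral_setLIntegral_swap_of_antitone (μ : Measure α) [SFinite μ] {g : ℝ → α → ℝ≥0∞}
    (hm : ∀ t, Measurable (g t)) (ha : ∀ x, Antitone fun t => g t x) (s : Set ℝ) :
    ∫⁻ x, (∫⁻ t in s, g t x) ∂μ = ∫⁻ t in s, ∫⁻ x, g t x ∂μ := by
  have ha' : Antitone fun t => ∫⁻ x, g t x ∂μ := fun _ _ h => lintegral_mono fun x => ha x h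
  calc ∫⁻ x, (∫⁻ t in s, g t x) ∂μ
      = ∫⁻ x, (∫⁻ t in s, ⨆ n, g (dyadicAbove n t) x) ∂μ := lintegral_congr fun x =>
        lintegral_congr_ae (ae_restrict_of_ae ((ae_iSup_dyadicAbove (ha x)).mono fun _ h => h.symm))
    _ = ∫⁻ t in s, ∫⁻ x, ⨆ n, g (dyadicAbove n t) x ∂μ :=
        (lintegral_lintegral_swap (measurable_iSup_dyadicAbove hm).aemeasurable).symm
    _ = ∫⁻ t in s, ⨆ n, ∫⁻ x, g (dyadicAbove n t) x ∂μ := lintegral_congr fun t =>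
        lintegral_iSup (fun n => hm _) fun m n h x => ha x (antitone_dyadicAbove t h)
    _ = ∫⁻ t in s, ∫⁻ x, g t x ∂μ :=
        lintegral_congr_ae (ae_restrict_of_ae (ae_iSup_dyadicAbove ha'))

end MAP

/-! ### Powers of an integral through its tails -/

namespace MAP

lemma continuous_intervalIntegral_left {f : ℝ → ℝ}
    (hi : ∀ a b, IntervalIntegrable f volume a b) (T : ℝ) :
    Continuous fun t => ∫ s in t..T, f s := by
  rw [show (fun t => ∫ s in t..T, f s) = fun t => -∫ s in T..t, f s from
    funext fun t => intervalIntegral.integral_symm T t]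
  exact (intervalIntegral.continuous_primitive hi T).neg

/-- The integrand is the derivative of `-(∫_t^T f)^{k+1}` wherever `f` is continuous, that is, off a
countable set. -/
lemma integral_mul_pow_tail_of_antitone {f : ℝ → ℝ} (hf : Antitone f) (T : ℝ) (k : ℕ) :
    ∫ t in (0 : ℝ)..T, ((k : ℝ) + 1) * (f t * (∫ s in t..T, f s) ^ k)
      = (∫ s in (0 : ℝ)..T, f s) ^ (k + 1) := by
  have hi : ∀ a b, IntervalIntegrable f volume a b := fun a b =>
    (hf.antitoneOn _).intervalIntegrable
  have hG := continuous_intervalIntegral_left hi T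
  have h := integral_eq_of_hasDerivAt_off_countable (E := ℝ)
    (fun t => -(∫ s in t..T, f s) ^ (k + 1))
    (fun t => ((k : ℝ) + 1) * (f t * (∫ s in t..T, f s) ^ k)) (a := 0) (b := T)
    (s := {t | ¬ ContinuousAt f t}) hf.countable_not_continuousAt
    (hG.pow _).neg.continuousOn ?_ ?_
  · rw [h]; simp
  · intro t ht
    have hc : ContinuousAt f t := by simpa using ht.2
    have hd : HasDerivAt (fun t => ∫ s in t..T, f s) (-f t) t :=
      intervalIntegral.integral_hasDerivAt_left (hi _ _)
        hf.measurable.stronglyMeasurable.stronglyMeasurableAtFilter hc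
    refine (hd.pow (k + 1)).neg.congr_deriv ?_
    rw [Nat.add_sub_cancel]
    push_cast
    ring
  · exact ((hi _ _).mul_continuousOn (hG.pow k).continuousOn).const_mul _

lemma setLIntegral_Icc_pow_succ {f : ℝ → ℝ≥0∞} (hf : Antitone f) (h1 : ∀ t, f t ≤ 1) {T : ℝ}
    (hT : 0 ≤ T) (k : ℕ) :
    (∫⁻ t in Icc 0 T, f t) ^ (k + 1)
      = (k + 1) * ∫⁻ t in Icc 0 T, f t * (∫⁻ s in Icc t T, f s) ^ k := by
  have hfin : ∀ t, f t ≠ ∞ := fun t => ne_top_of_le_ne_top ENNReal.one_ne_top (h1 t)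
  have hr : Antitone fun t => (f t).toReal := fun a b h =>
    ENNReal.toReal_mono (hfin _) (hf h)
  have hint : ∀ a b, IntervalIntegrable (fun t => (f t).toReal) volume a b := fun a b =>
    (hr.antitoneOn _).intervalIntegrable
  have key : ∀ t, t ≤ T → ∫⁻ s in Icc t T, f s = ENNReal.ofReal (∫ s in t..T, (f s).toReal) := by
    intro t ht
    rw [intervalIntegral.integral_of_le ht, ← integral_Icc_eq_integral_Ioc,
      ofReal_integral_eq_lintegral_ofReal]
    · simp [hfin]
    · exact (intervalIntegrable_iff_integrableOn_Icc_of_le ht).1 (hint t T)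
    · exact Eventually.of_forall fun _ => ENNReal.toReal_nonneg
  have hnn : ∀ t, t ≤ T → 0 ≤ ∫ s in t..T, (f s).toReal := fun t ht =>
    intervalIntegral.integral_nonneg ht fun _ _ => ENNReal.toReal_nonneg
  have hG := continuous_intervalIntegral_left hint T
  have h := integral_mul_pow_tail_of_antitone hr T k
  rw [key 0 hT, ← ENNReal.ofReal_pow (hnn 0 hT), ← h, intervalIntegral.integral_const_mul,
    ENNReal.ofReal_mul (by positivity)]
  congr 1
  · rw [ENNReal.ofReal_add (by positivity) (by positivity)]; simp
  rw [intervalIntegral.integral_of_le hT, ← integral_Icc_eq_integral_Ioc,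
    ofReal_integral_eq_lintegral_ofReal]
  · refine setLIntegral_congr_fun measurableSet_Icc fun t ht => ?_
    rw [ENNReal.ofReal_mul ENNReal.toReal_nonneg, ENNReal.ofReal_pow (hnn t ht.2), key t ht.2,
      ENNReal.ofReal_toReal (hfin t)]
  · exact (intervalIntegrable_iff_integrableOn_Icc_of_le hT).1
      ((hint 0 T).mul_continuousOn (hG.pow k).continuousOn)
  · filter_upwards [ae_restrict_mem measurableSet_Icc] with t ht
    exact mul_nonneg ENNReal.toReal_nonneg (pow_nonneg (hnn t ht.2) _)

lemma iSup_setLIntegral_Icc (g : ℝ → ℝ≥0∞) (t : ℝ) :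
    ⨆ n : ℕ, ∫⁻ s in Icc t n, g s = ∫⁻ s in Ici t, g s := by
  have hu : Ici t = ⋃ n : ℕ, Icc t (n : ℝ) := by
    ext s
    simp only [mem_Ici, mem_iUnion, mem_Icc, exists_and_left]
    exact ⟨fun h => ⟨h, exists_nat_ge s⟩, fun h => h.1⟩
  rw [hu, setLIntegral_iUnion_of_directed]
  exact (monotone_nat_of_le_succ fun n => Icc_subset_Icc_right (by push_cast; linarith)).directed_le

/-- The integral may be infinite, so the identity is proved on `[0, n]` and passed to the limit by
monotone convergence. -/
lemma setLIntegral_Ici_pow_succ {f : ℝ → ℝ≥0∞} (hf : Antitone f) (h1 : ∀ t, f t ≤ 1) (k : ℕ) :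
    (∫⁻ t in Ici 0, f t) ^ (k + 1)
      = (k + 1) * ∫⁻ t in Ici 0, f t * (∫⁻ s in Ici t, f s) ^ k := by
  have hmono : ∀ t, Monotone fun n : ℕ => ∫⁻ s in Icc t (n : ℝ), f s := fun t m n h =>
    lintegral_mono_set (Icc_subset_Icc_right (by exact_mod_cast h))
  have hsup : ∀ (a : ℕ → ℝ≥0∞) (m : ℕ), Monotone a → (⨆ n, a n) ^ m = ⨆ n, a n ^ m := by
    intro a m ha
    exact tendsto_nhds_unique ((ENNReal.continuous_pow m).continuousAt.tendsto.comp
      (tendsto_atTop_iSup ha)) (tendsto_atTop_iSup fun i j h => pow_le_pow_left' (ha h) m)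
  have hL : (∫⁻ t in Ici 0, f t) ^ (k + 1) = ⨆ n : ℕ, (∫⁻ t in Icc 0 (n : ℝ), f t) ^ (k + 1) := by
    rw [← iSup_setLIntegral_Icc, hsup _ _ (hmono 0)]
  have hm : ∀ n : ℕ, Measurable fun t => f t * (∫⁻ s in Icc t (n : ℝ), f s) ^ k := fun n =>
    hf.measurable.mul ((Antitone.measurable fun a b h =>
      lintegral_mono_set (Icc_subset_Icc_left h)).pow_const k)
  have hR : ∫⁻ t in Ici 0, f t * (∫⁻ s in Ici t, f s) ^ k
      = ⨆ n : ℕ, ∫⁻ t in Icc 0 (n : ℝ), f t * (∫⁻ s in Icc t (n : ℝ), f s) ^ k := by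
    have e : ∀ t, (Ici (0 : ℝ)).indicator (fun t => f t * (∫⁻ s in Ici t, f s) ^ k) t
        = ⨆ n : ℕ, (Icc 0 (n : ℝ)).indicator
          (fun t => f t * (∫⁻ s in Icc t (n : ℝ), f s) ^ k) t := by
      intro t
      by_cases ht : 0 ≤ t
      · rw [indicator_of_mem (by exact ht), ← iSup_setLIntegral_Icc, hsup _ _ (hmono t),
          ENNReal.mul_iSup]
        apply le_antisymm
        · refine iSup_le fun n => ?_
          obtain ⟨m, hm⟩ := exists_nat_ge t
          -- If `t` lies outside `[0, n]`, the indicator vanishes; enlarging the window to contain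
          -- `t` only increases the tail.
          refine le_iSup_of_le (max m n) ?_
          rw [indicator_of_mem]
          · exact mul_le_mul_right (pow_le_pow_left' (hmono t (le_max_right m n)) k) _
          · exact ⟨ht, hm.trans (by exact_mod_cast le_max_left m n)⟩
        · exact iSup_mono fun n => indicator_le_self _ _ _
      · rw [indicator_of_notMem (by simpa using ht)]
        symm
        rw [ENNReal.iSup_eq_zero]
        exact fun n => indicator_of_notMem (fun h => ht h.1) _
    rw [← lintegral_indicator measurableSet_Ici]
    rw [lintegral_congr e]
    simp_rw [fun n : ℕ => (lintegral_indicator (μ := volume) (measurableSet_Icc (a := (0 : ℝ))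
      (b := n)) (fun t => f t * (∫⁻ s in Icc t (n : ℝ), f s) ^ k)).symm]
    refine lintegral_iSup (fun n => (hm n).indicator measurableSet_Icc) fun m n h t => ?_
    simp only [indicator]
    have hmn : (m : ℝ) ≤ n := by exact_mod_cast h
    split_ifs with h₁ h₂
    · gcongr
    · exact absurd ⟨h₁.1, h₁.2.trans hmn⟩ h₂
    · exact zero_le
    · exact le_rfl
  rw [hL, hR, ENNReal.mul_iSup]
  exact iSup_congr fun n => setLIntegral_Icc_pow_succ hf h1 (Nat.cast_nonneg n) k

end MAP

/-! ### The Markov additive property and the moment recursion -/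

namespace MAP

/-- The function `x ↦ e^{-x}` on `[0, ∞]`. -/
def negExp (x : ℝ≥0∞) : ℝ≥0∞ := EReal.exp (-(x : EReal))

@[simp] lemma negExp_top : negExp ∞ = 0 := by simp [negExp]

@[simp] lemma negExp_zero : negExp 0 = 1 := by simp [negExp]

lemma antitone_negExp : Antitone negExp := fun x y h => by
  simpa [negExp] using h

lemma negExp_le_one (x : ℝ≥0∞) : negExp x ≤ 1 := by
  simpa using antitone_negExp (zero_le (a := x))

lemma measurable_negExp : Measurable negExp := antitone_negExp.measurable

lemma negExp_eq_ofReal {x : ℝ≥0∞} (hx : x ≠ ∞) :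
    negExp x = ENNReal.ofReal (Real.exp (-x.toReal)) := by
  lift x to ℝ≥0 using hx
  have h : (-((x : ℝ≥0∞) : EReal)) = ((-(x : ℝ) : ℝ) : EReal) := by
    rw [EReal.coe_neg]; rfl
  rw [negExp, h, EReal.exp_coe]
  rfl

lemma negExp_add (x y : ℝ≥0∞) : negExp (x + y) = negExp x * negExp y := by
  by_cases hx : x = ∞
  · simp [hx]
  by_cases hy : y = ∞
  · simp [hy]
  rw [negExp_eq_ofReal hx, negExp_eq_ofReal hy, negExp_eq_ofReal (ENNReal.add_ne_top.2 ⟨hx, hy⟩),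
    ← ENNReal.ofReal_mul (Real.exp_nonneg _), ← Real.exp_add, ENNReal.toReal_add hx hy, neg_add]

lemma negExp_pow_eq_ofReal {x : ℝ≥0∞} (hx : x ≠ ∞) (k : ℕ) :
    negExp x ^ k = ENNReal.ofReal (Real.exp (-(k * x.toReal))) := by
  rw [negExp_eq_ofReal hx, ← ENNReal.ofReal_pow (Real.exp_nonneg _), ← Real.exp_nat_mul, mul_neg]

variable {K : ℕ}

/-- A functional of the path that is measurable for the product `σ`-algebra and that agrees with
the exponential functional on monotone paths. -/
def pathFunctional (w : ℝ≥0 → ℝ≥0∞ × Option (Fin K)) : ℝ≥0∞ :=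
  ∫⁻ t in Ici (0 : ℝ), ⨆ n, negExp (w (dyadicAbove n t).toNNReal).1

lemma measurable_pathFunctional : Measurable (pathFunctional (K := K)) :=
  measurable_setLIntegral_iSup_dyadicAbove
    (g := fun (t : ℝ) (w : ℝ≥0 → ℝ≥0∞ × Option (Fin K)) => negExp (w t.toNNReal).1)
    (fun t => measurable_negExp.comp (measurable_fst.comp (measurable_pi_apply t.toNNReal))) _

lemma antitone_negExp_toNNReal {x : ℝ≥0 → ℝ≥0∞} (hx : Monotone x) :
    Antitone fun t : ℝ => negExp (x t.toNNReal) :=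
  fun _ _ h => antitone_negExp (hx (Real.toNNReal_mono h))

lemma pathFunctional_eq {w : ℝ≥0 → ℝ≥0∞ × Option (Fin K)} (hw : Monotone fun t => (w t).1) :
    pathFunctional w = ∫⁻ t in Ici (0 : ℝ), negExp (w t.toNNReal).1 :=
  lintegral_congr_ae (ae_restrict_of_ae (ae_iSup_dyadicAbove (antitone_negExp_toNNReal hw)))

lemma setLIntegral_Ici_eq_translate (f : ℝ → ℝ≥0∞) (t : ℝ) :
    ∫⁻ s in Ici t, f s = ∫⁻ s in Ici (0 : ℝ), f (t + s) := by
  rw [← lintegral_indicator measurableSet_Ici, ← lintegral_indicator measurableSet_Ici,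
    ← lintegral_add_left_eq_self _ t]
  refine lintegral_congr fun s => ?_
  simp [indicator]

variable {Ω : Type*} [MeasurableSpace Ω] {P : Fin K → Measure Ω}
  {ξ : ℝ≥0 → Ω → ℝ≥0∞} {J : ℝ≥0 → Ω → Option (Fin K)}

namespace IsNondecreasingMAP

lemma expFunctional_eq (h : IsNondecreasingMAP P ξ J) (ω : Ω) :
    expFunctional ξ ω = pathFunctional (path ξ J ω) :=
  (pathFunctional_eq (w := path ξ J ω) (h.monotone ω)).symm

/-- By monotonicity `ξ_{t+s} = ξ_t + (ξ_{t+s} - ξ_t)` even with truncated subtraction; when `ξ_t =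
∞` both sides vanish. -/
lemma setLIntegral_negExp (h : IsNondecreasingMAP P ξ J) (ω : Ω) {t : ℝ} (ht : 0 ≤ t) :
    ∫⁻ s in Ici t, negExp (ξ s.toNNReal ω)
      = negExp (ξ t.toNNReal ω) * pathFunctional (shiftedPath ξ J t.toNNReal ω) := by
  have hmono : Monotone fun s => (shiftedPath ξ J t.toNNReal ω s).1 := fun a b hab =>
    tsub_le_tsub_right (h.monotone ω (by gcongr)) _
  rw [pathFunctional_eq hmono, setLIntegral_Ici_eq_translate,
    ← lintegral_const_mul _ (antitone_negExp_toNNReal hmono).measurable]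
  refine setLIntegral_congr_fun measurableSet_Ici fun s hs => ?_
  simp only [shiftedPath]
  rw [← negExp_add, add_tsub_cancel_of_le (h.monotone ω le_self_add),
    Real.toNNReal_add ht hs]

lemma measurable_path (h : IsNondecreasingMAP P ξ J) : Measurable (path ξ J) :=
  measurable_pi_lambda _ fun s => (h.measurable_position s).prodMk (h.measurable_type s)

lemma measurable_shiftedPath (h : IsNondecreasingMAP P ξ J) (t : ℝ≥0) :
    Measurable (shiftedPath ξ J t) :=
  measurable_pi_lambda _ fun s =>
    ((h.measurable_position (t + s)).sub (h.measurable_position t)).prodMk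
      (h.measurable_type (t + s))

lemma measurableSet_type (h : IsNondecreasingMAP P ξ J) (t : ℝ≥0) (j : Fin K) :
    MeasurableSet {ω | J t ω = some j} :=
  h.measurable_type t (MeasurableSpace.measurableSet_top (s := {some j}))

/-- On `{J_t = j}` the joint law of `ξ_t` and the shifted path is a product measure: the Markov
additive property says so on rectangles. -/
lemma lintegral_mul_shiftedPath (h : IsNondecreasingMAP P ξ J) (i j : Fin K) (t : ℝ≥0)
    {F : ℝ≥0∞ → ℝ≥0∞} (hF : Measurable F) {H : (ℝ≥0 → ℝ≥0∞ × Option (Fin K)) → ℝ≥0∞}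
    (hH : Measurable H) :
    ∫⁻ ω in {ω | J t ω = some j}, F (ξ t ω) * H (shiftedPath ξ J t ω) ∂(P i)
      = (∫⁻ ω in {ω | J t ω = some j}, F (ξ t ω) ∂(P i)) * ∫⁻ ω, H (path ξ J ω) ∂(P j) := by
  have := h.prob i
  have := h.prob j
  have hX := h.measurable_position t
  have hS := h.measurable_shiftedPath t
  have hA := h.measurableSet_type t j
  have hprod : (((P i).restrict {ω | J t ω = some j}).map (ξ t)).prod ((P j).map (path ξ J))
      = ((P i).restrict {ω | J t ω = some j}).map fun ω => (ξ t ω, shiftedPath ξ J t ω) := by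
    refine Measure.prod_eq fun B C hB hC => ?_
    rw [Measure.map_apply (hX.prodMk hS) (hB.prod hC), Measure.map_apply hX hB,
      Measure.map_apply h.measurable_path hC, Measure.restrict_apply (hX hB),
      Measure.restrict_apply ((hX.prodMk hS) (hB.prod hC))]
    have hpast : MeasurableSet[past ξ J t] (ξ t ⁻¹' B) := by
      have hle : MeasurableSpace.comap (fun ω => (ξ t ω, J t ω)) inferInstance ≤ past ξ J t :=
        le_iSup₂_of_le t le_rfl le_rfl
      exact hle _ ⟨Prod.fst ⁻¹' B, measurable_fst hB, rfl⟩
    refine Eq.trans (congrArg (P i) ?_) (h.markov_additive i j t _ hpast C hC)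
    ext ω
    simp only [mem_inter_iff, mem_preimage, mem_prod, mem_ofPred_eq]
    tauto
  have hFH : Measurable fun z : ℝ≥0∞ × (ℝ≥0 → ℝ≥0∞ × Option (Fin K)) => F z.1 * H z.2 :=
    (hF.comp measurable_fst).mul (hH.comp measurable_snd)
  rw [← lintegral_map hF hX, ← lintegral_map hH h.measurable_path,
    ← lintegral_prod_mul hF.aemeasurable hH.aemeasurable, hprod, lintegral_map hFH (hX.prodMk hS)]

lemma lintegral_eq_sum_type (h : IsNondecreasingMAP P ξ J) (μ : Measure Ω) (t : ℝ≥0)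
    {g : Ω → ℝ≥0∞} (hg : ∀ ω, J t ω = none → g ω = 0) :
    ∫⁻ ω, g ω ∂μ = ∑ j, ∫⁻ ω in {ω | J t ω = some j}, g ω ∂μ := by
  have hsupp : ∫⁻ ω, g ω ∂μ = ∫⁻ ω in ⋃ j, {ω | J t ω = some j}, g ω ∂μ := by
    rw [← lintegral_indicator (MeasurableSet.iUnion fun j => h.measurableSet_type t j)]
    congr 1
    refine (indicator_eq_self.2 fun ω hω => ?_).symm
    obtain ⟨j, hj⟩ := Option.ne_none_iff_exists'.1 fun h0 => hω (hg ω h0)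
    exact mem_iUnion.2 ⟨j, hj⟩
  rw [hsupp, lintegral_iUnion (fun j => h.measurableSet_type t j), tsum_fintype]
  intro a b hab
  refine disjoint_left.2 fun ω (h1 : J t ω = _) (h2 : J t ω = _) => hab ?_
  exact Option.some_injective _ (h1.symm.trans h2)

end IsNondecreasingMAP

/-- The Laplace transform `E_i[e^{-k ξ_t}, J_t = j]`. -/
def laplace (P : Fin K → Measure Ω) (ξ : ℝ≥0 → Ω → ℝ≥0∞) (J : ℝ≥0 → Ω → Option (Fin K))
    (k : ℕ) (t : ℝ≥0) (i j : Fin K) : ℝ≥0∞ :=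
  ∫⁻ ω in {ω | J t ω = some j}, negExp (ξ t ω) ^ k ∂(P i)

namespace IsNondecreasingMAP

/-- Chapman–Kolmogorov: `e^{-kξ}` is multiplicative along increments, and the second factor is a
functional of the shifted path. -/
lemma laplace_add (h : IsNondecreasingMAP P ξ J) (k : ℕ) (t s : ℝ≥0) (i j : Fin K) :
    laplace P ξ J k (t + s) i j = ∑ l, laplace P ξ J k t i l * laplace P ξ J k s l j := by
  rw [laplace, ← lintegral_indicator (h.measurableSet_type _ j), h.lintegral_eq_sum_type (P i) t]
  · refine Finset.sum_congr rfl fun l _ => ?_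
    set S : Set (ℝ≥0 → ℝ≥0∞ × Option (Fin K)) := {w | (w s).2 = some j} with hS
    have hSm : MeasurableSet S :=
      (measurable_snd.comp (measurable_pi_apply s)) (MeasurableSpace.measurableSet_top (s := {some j}))
    have hH : Measurable (S.indicator fun w => negExp (w s).1 ^ k) :=
      ((measurable_negExp.comp (measurable_fst.comp (measurable_pi_apply s))).pow_const k).indicator
        hSm
    have e := h.lintegral_mul_shiftedPath i l t (measurable_negExp.pow_const k) hH
    have e2 : ∫⁻ ω, S.indicator (fun w => negExp (w s).1 ^ k) (path ξ J ω) ∂(P l)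
        = laplace P ξ J k s l j := by
      rw [laplace, ← lintegral_indicator (h.measurableSet_type _ j)]
      rfl
    rw [e2] at e
    refine Eq.trans (lintegral_congr fun ω => ?_) e
    simp only [indicator, hS, shiftedPath, mem_ofPred_eq]
    split_ifs
    · rw [← mul_pow, ← negExp_add, add_tsub_cancel_of_le (h.monotone ω le_self_add)]
    · simp
  -- Absorption makes the indicator itself vanish, which covers `k = 0`, where `negExp ∞ ^ k` would
  -- be `1`.
  · intro ω hω
    refine indicator_of_notMem (fun hj => ?_) _
    have h1 : ξ t ω = ∞ := (h.dead_iff t ω).2 hω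
    have h2 : ξ (t + s) ω = ∞ := top_le_iff.1 (h1 ▸ h.monotone ω le_self_add)
    rw [mem_ofPred_eq, (h.dead_iff _ ω).1 h2] at hj
    cases hj

lemma sum_laplace (h : IsNondecreasingMAP P ξ J) {k : ℕ} (hk : k ≠ 0) (t : ℝ≥0) (i : Fin K) :
    ∑ j, laplace P ξ J k t i j = ∫⁻ ω, negExp (ξ t ω) ^ k ∂(P i) := by
  refine (h.lintegral_eq_sum_type (P i) t fun ω hω => ?_).symm
  rw [(h.dead_iff t ω).2 hω, negExp_top, zero_pow hk]

lemma laplace_le_one (h : IsNondecreasingMAP P ξ J) (k : ℕ) (t : ℝ≥0) (i j : Fin K) :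
    laplace P ξ J k t i j ≤ 1 := by
  have := h.prob i
  calc laplace P ξ J k t i j ≤ ∫⁻ ω, 1 ∂(P i) :=
        (setLIntegral_le_lintegral _ _).trans
          (lintegral_mono fun ω => pow_le_one₀ zero_le (negExp_le_one _))
    _ = 1 := by simp

lemma laplace_anti (P : Fin K → Measure Ω) (ξ : ℝ≥0 → Ω → ℝ≥0∞) (J : ℝ≥0 → Ω → Option (Fin K))
    (t : ℝ≥0) (i j : Fin K) : Antitone fun k => laplace P ξ J k t i j :=
  fun _ _ hkl => lintegral_mono fun _ => pow_le_pow_of_le_one zero_le (negExp_le_one _) hkl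

lemma laplace_zero (h : IsNondecreasingMAP P ξ J) (k : ℕ) (i j : Fin K) :
    laplace P ξ J k 0 i j = if i = j then 1 else 0 := by
  have := h.prob i
  rw [laplace, ← lintegral_indicator (h.measurableSet_type _ j)]
  have e : ∫⁻ ω, {ω | J 0 ω = some j}.indicator (fun ω => negExp (ξ 0 ω) ^ k) ω ∂(P i)
      = ∫⁻ ω, (if i = j then 1 else 0) ∂(P i) := by
    refine lintegral_congr_ae ?_
    filter_upwards [h.start i] with ω hω
    simp [indicator, hω.1, hω.2]
  rw [e]
  simp

lemma moment_succ (h : IsNondecreasingMAP P ξ J) (k : ℕ) (i : Fin K) :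
    moment P ξ (k + 1) i = (k + 1) * ∫⁻ t in Ici (0 : ℝ),
      ∑ j, laplace P ξ J (k + 1) t.toNNReal i j * moment P ξ k j := by
  have := h.prob i
  have hanti : ∀ ω, Antitone fun t : ℝ => negExp (ξ t.toNNReal ω) := fun ω =>
    antitone_negExp_toNNReal (h.monotone ω)
  have hmeas : ∀ t : ℝ, Measurable fun ω => negExp (ξ t.toNNReal ω) := fun t =>
    measurable_negExp.comp (h.measurable_position _)
  have hg : ∀ t : ℝ, Measurable fun ω =>
      negExp (ξ t.toNNReal ω) * (∫⁻ s in Ici t, negExp (ξ s.toNNReal ω)) ^ k := fun t =>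
    (hmeas t).mul ((measurable_setLIntegral_of_antitone hmeas hanti _).pow_const k)
  -- The whole integrand is antitone in `t`, so the monotone form of Tonelli applies to it.
  have hga : ∀ ω, Antitone fun t : ℝ =>
      negExp (ξ t.toNNReal ω) * (∫⁻ s in Ici t, negExp (ξ s.toNNReal ω)) ^ k := fun ω a b hab =>
    mul_le_mul' (hanti ω hab)
      (pow_le_pow_left' (lintegral_mono_set (Ici_subset_Ici.2 hab)) k)
  calc moment P ξ (k + 1) i
      = ∫⁻ ω, ((k + 1) * ∫⁻ t in Ici (0 : ℝ), negExp (ξ t.toNNReal ω)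
          * (∫⁻ s in Ici t, negExp (ξ s.toNNReal ω)) ^ k) ∂(P i) :=
        lintegral_congr fun ω => setLIntegral_Ici_pow_succ (hanti ω) (fun _ => negExp_le_one _) k
    _ = (k + 1) * ∫⁻ t in Ici (0 : ℝ), ∫⁻ ω, negExp (ξ t.toNNReal ω)
          * (∫⁻ s in Ici t, negExp (ξ s.toNNReal ω)) ^ k ∂(P i) := by
        rw [lintegral_const_mul _ (measurable_setLIntegral_of_antitone hg hga _),
          lintegral_setLIntegral_swap_of_antitone _ hg hga]
    _ = _ := by
        congr 1
        refine setLIntegral_congr_fun measurableSet_Ici fun t ht => ?_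
        rw [h.lintegral_eq_sum_type (P i) t.toNNReal]
        · refine Finset.sum_congr rfl fun j _ => ?_
          have e := h.lintegral_mul_shiftedPath i j t.toNNReal
            (measurable_negExp.pow_const (k + 1)) (measurable_pathFunctional.pow_const k)
          have e2 : ∫⁻ ω, pathFunctional (path ξ J ω) ^ k ∂(P j) = moment P ξ k j :=
            lintegral_congr fun ω => by rw [h.expFunctional_eq]
          rw [e2] at e
          refine Eq.trans (lintegral_congr fun ω => ?_) e
          rw [h.setLIntegral_negExp ω ht, mul_pow, ← mul_assoc, pow_succ']
        · intro ω hω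
          rw [(h.dead_iff _ ω).2 hω, negExp_top, zero_mul]

end IsNondecreasingMAP

end MAP

/-! ### The Bernstein matrix and its invertibility -/

namespace MAP

lemma one_sub_exp_nonneg {y : ℝ} (hy : 0 ≤ y) : 0 ≤ 1 - Real.exp (-y) := by
  have : Real.exp (-y) ≤ 1 := Real.exp_le_one_iff.2 (by linarith)
  linarith

lemma one_sub_exp_pos {y : ℝ} (hy : 0 < y) : 0 < 1 - Real.exp (-y) := by
  have : Real.exp (-y) < 1 := Real.exp_lt_one_iff.2 (by linarith)
  linarith

namespace Characteristics

variable {K : ℕ} (χ : Characteristics K)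

lemma integrable_exp_jump {p : ℝ} (hp : 0 ≤ p) (i j : Fin K) :
    IntegrableOn (fun x => Real.exp (-(p * x))) (Ici 0) (χ.jump i j) := by
  have := χ.jump_prob i j
  refine Integrable.mono' (integrable_const 1) (by fun_prop) ?_
  filter_upwards [ae_restrict_mem measurableSet_Ici] with x hx
  rw [Real.norm_eq_abs, abs_of_pos (Real.exp_pos _), Real.exp_le_one_iff]
  have := mul_nonneg hp hx
  linarith

lemma jumpLaplace_nonneg (p : ℝ) (i j : Fin K) : 0 ≤ χ.jumpLaplace p i j :=
  integral_nonneg fun _ => (Real.exp_pos _).le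

lemma one_sub_jumpLaplace {p : ℝ} (hp : 0 ≤ p) (i j : Fin K) :
    1 - χ.jumpLaplace p i j = ∫ x in Ici 0, (1 - Real.exp (-(p * x))) ∂(χ.jump i j) := by
  have := χ.jump_prob i j
  have h1 : (χ.jump i j).real (Ici 0) = 1 := by
    have h := measureReal_compl (μ := χ.jump i j) (measurableSet_Iio (a := (0 : ℝ)))
    rw [compl_Iio] at h
    simpa [Measure.real, χ.jump_supp] using h
  rw [integral_sub (integrable_const 1) (χ.integrable_exp_jump hp i j)]
  simp [jumpLaplace, h1]

lemma jumpLaplace_le_one {p : ℝ} (hp : 0 ≤ p) (i j : Fin K) : χ.jumpLaplace p i j ≤ 1 := by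
  rw [← sub_nonneg, χ.one_sub_jumpLaplace hp]
  exact setIntegral_nonneg measurableSet_Ici fun x hx => one_sub_exp_nonneg (mul_nonneg hp hx)

lemma jumpLaplace_lt_one {p : ℝ} (hp : 0 < p) {i j : Fin K} (h : 0 < χ.jump i j (Ioi 0)) :
    χ.jumpLaplace p i j < 1 := by
  have := χ.jump_prob i j
  rw [← sub_pos, χ.one_sub_jumpLaplace hp.le, setIntegral_pos_iff_support_of_nonneg_ae]
  · refine h.trans_le (measure_mono fun x hx => ⟨?_, mem_Ici.2 (le_of_lt hx)⟩)
    exact (one_sub_exp_pos (mul_pos hp hx)).ne'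
  · filter_upwards [ae_restrict_mem measurableSet_Ici] with x hx
    exact one_sub_exp_nonneg (mul_nonneg hp.le hx)
  · exact (integrable_const 1).sub (χ.integrable_exp_jump hp.le i j)

lemma jumpLaplace_self (p : ℝ) (i : Fin K) : χ.jumpLaplace p i i = 1 := by
  simp [jumpLaplace, χ.jump_self, setIntegral_dirac]

lemma integrable_one_sub_exp_levy {p : ℝ} (hp : 0 ≤ p) (i : Fin K) :
    IntegrableOn (fun x => 1 - Real.exp (-(p * x))) (Ioi 0) (χ.levy i) := by
  have hmin : IntegrableOn (fun x : ℝ => min 1 x) (Ioi 0) (χ.levy i) := by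
    refine ⟨by fun_prop, ?_⟩
    refine lt_of_le_of_lt ?_ (χ.levy_finite i)
    refine (setLIntegral_mono' measurableSet_Ioi fun x hx => ?_).trans
      (setLIntegral_le_lintegral (Ioi 0) _)
    rw [Real.enorm_eq_ofReal (le_min zero_le_one (le_of_lt hx))]
  refine Integrable.mono' (hmin.const_mul (max 1 p)) (by fun_prop) ?_
  filter_upwards [ae_restrict_mem measurableSet_Ioi] with x hx
  have hx0 : (0 : ℝ) < x := hx
  rw [Real.norm_eq_abs, abs_of_nonneg (one_sub_exp_nonneg (mul_nonneg hp hx0.le))]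
  have h1 : 1 - Real.exp (-(p * x)) ≤ p * x := by
    have := Real.add_one_le_exp (-(p * x)); linarith
  have h2 : 1 - Real.exp (-(p * x)) ≤ 1 := by
    have := Real.exp_pos (-(p * x)); linarith
  rcases le_total 1 x with h | h
  · rw [min_eq_left h, mul_one]
    exact h2.trans (le_max_left _ _)
  · rw [min_eq_right h]
    exact h1.trans (mul_le_mul_of_nonneg_right (le_max_right _ _) hx0.le)

lemma levy_integral_nonneg {p : ℝ} (hp : 0 ≤ p) (i : Fin K) :
    0 ≤ ∫ x in Ioi 0, (1 - Real.exp (-(p * x))) ∂(χ.levy i) :=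
  setIntegral_nonneg measurableSet_Ioi fun _ hx =>
    one_sub_exp_nonneg (mul_nonneg hp (le_of_lt hx))

lemma psi_nonneg {p : ℝ} (hp : 0 ≤ p) (i : Fin K) : 0 ≤ χ.psi i p :=
  add_nonneg (add_nonneg (χ.kill_nonneg i) (mul_nonneg (χ.drift_nonneg i) hp))
    (χ.levy_integral_nonneg hp i)

/-- A Laplace exponent that vanishes at one positive point vanishes identically. -/
lemma psi_pos {p : ℝ} (hp : 0 < p) {i : Fin K} {q : ℝ} (hq : χ.psi i q ≠ 0) :
    0 < χ.psi i p := by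
  refine (χ.psi_nonneg hp.le i).lt_of_ne' fun h0 => hq ?_
  have hk := χ.kill_nonneg i
  have hd := mul_nonneg (χ.drift_nonneg i) hp.le
  have hl := χ.levy_integral_nonneg hp.le i
  rw [psi] at h0
  have hk0 : χ.kill i = 0 := by linarith
  have hd0 : χ.drift i = 0 := by
    have : χ.drift i * p = 0 := by linarith
    exact (mul_eq_zero.1 this).resolve_right hp.ne'
  have hl0 : ∫ x in Ioi 0, (1 - Real.exp (-(p * x))) ∂(χ.levy i) = 0 := by linarith
  rw [setIntegral_eq_zero_iff_of_nonneg_ae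
    (by
      filter_upwards [ae_restrict_mem measurableSet_Ioi] with x hx
      exact one_sub_exp_nonneg (mul_nonneg hp.le (le_of_lt hx)))
    (χ.integrable_one_sub_exp_levy hp.le i)] at hl0
  -- A strictly positive integrand with zero integral forces the Lévy measure to vanish, hence `ψ_i`
  -- at every `q`.
  have hfalse : ∀ᵐ x ∂(χ.levy i).restrict (Ioi 0), False := by
    filter_upwards [hl0, ae_restrict_mem measurableSet_Ioi] with x hx hx0
    exact (one_sub_exp_pos (mul_pos hp hx0)).ne' hx
  have hzero : (χ.levy i).restrict (Ioi 0) = 0 :=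
    ae_eq_bot.1 (eventually_false_iff_eq_bot.1 hfalse)
  simp [psi, hk0, hd0, hzero]

lemma bernstein_apply (p : ℝ) (i j : Fin K) :
    χ.bernstein p i j = (if i = j then χ.psi i p else 0) - χ.rate i j * χ.jumpLaplace p i j := by
  simp [bernstein, Matrix.diagonal_apply]

/-- The equality case of the maximum principle for the Bernstein matrix. -/
lemma eq_of_bernstein_mulVec_eq_zero {p : ℝ} (hp : 0 ≤ p) {v : Fin K → ℝ}
    (hv : (χ.bernstein p).mulVec v = 0) {m : ℝ} (hm : 0 < m) (hle : ∀ j, |v j| ≤ m) {i : Fin K}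
    (hi : |v i| = m) :
    χ.psi i p = 0 ∧ ∀ j, 0 < χ.rate i j → |v j| = m ∧ χ.jumpLaplace p i j = 1 := by
  have h0 : χ.psi i p * v i - ∑ j, χ.rate i j * χ.jumpLaplace p i j * v j = 0 := by
    have := congrFun hv i
    simpa [Matrix.mulVec, dotProduct, bernstein_apply, sub_mul, Finset.sum_sub_distrib] using this
  have hrate : χ.rate i i + ∑ j ∈ Finset.univ.erase i, χ.rate i j = 0 := by
    rw [Finset.add_sum_erase _ _ (Finset.mem_univ i)]; exact χ.rate_sum i
  rw [← Finset.add_sum_erase _ _ (Finset.mem_univ i), χ.jumpLaplace_self, mul_one] at h0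
  have hr : ∀ j ∈ Finset.univ.erase i, 0 ≤ χ.rate i j := fun j hj =>
    χ.rate_nonneg i j (Finset.ne_of_mem_erase hj).symm
  have hs0 : 0 ≤ ∑ j ∈ Finset.univ.erase i, χ.rate i j := Finset.sum_nonneg hr
  have hpsi := χ.psi_nonneg hp i
  have hB : ∀ j, χ.jumpLaplace p i j * |v j| ≤ m := fun j =>
    (mul_le_of_le_one_left (abs_nonneg _) (χ.jumpLaplace_le_one hp i j)).trans (hle j)
  -- Zero row sums and `B_{i,i} = δ_0` make the diagonal entry `ψ_i(p) + ∑_{j≠i} λ_{i,j}`; take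
  -- absolute values in row `i`.
  have habs : (χ.psi i p + ∑ j ∈ Finset.univ.erase i, χ.rate i j) * m
      ≤ ∑ j ∈ Finset.univ.erase i, χ.rate i j * (χ.jumpLaplace p i j * |v j|) := by
    have e : (χ.psi i p + ∑ j ∈ Finset.univ.erase i, χ.rate i j) * v i
        = ∑ j ∈ Finset.univ.erase i, χ.rate i j * χ.jumpLaplace p i j * v j := by
      rw [show ∑ j ∈ Finset.univ.erase i, χ.rate i j = -χ.rate i i by linarith]
      linarith
    calc _ = |(χ.psi i p + ∑ j ∈ Finset.univ.erase i, χ.rate i j) * v i| := by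
          rw [abs_mul, hi, abs_of_nonneg (add_nonneg hpsi hs0)]
      _ ≤ _ := by
          rw [e]
          refine (Finset.abs_sum_le_sum_abs _ _).trans (Finset.sum_le_sum fun j hj => ?_)
          rw [abs_mul, abs_mul, abs_of_nonneg (hr j hj),
            abs_of_nonneg (χ.jumpLaplace_nonneg p i j), mul_assoc]
  -- Each summand is nonnegative, so all of them vanish.
  have hsum : χ.psi i p * m
      + ∑ j ∈ Finset.univ.erase i, χ.rate i j * (m - χ.jumpLaplace p i j * |v j|) ≤ 0 := by
    simp only [mul_sub, Finset.sum_sub_distrib, ← Finset.sum_mul]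
    linarith
  have ht : ∀ j ∈ Finset.univ.erase i, 0 ≤ χ.rate i j * (m - χ.jumpLaplace p i j * |v j|) :=
    fun j hj => mul_nonneg (hr j hj) (sub_nonneg.2 (hB j))
  have hpm := mul_nonneg hpsi hm.le
  have hsn := Finset.sum_nonneg ht
  refine ⟨(mul_eq_zero.1 (show χ.psi i p * m = 0 by linarith)).resolve_right hm.ne', ?_⟩
  intro j hj
  have hji : j ≠ i := by
    rintro rfl
    linarith
  have hz := (Finset.sum_eq_zero_iff_of_nonneg ht).1 (by linarith) j (by simp [hji])
  have hBm : χ.jumpLaplace p i j * |v j| = m := by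
    have := (mul_eq_zero.1 hz).resolve_left hj.ne'
    linarith
  have hB1 := χ.jumpLaplace_le_one hp i j
  have hv1 := hle j
  have hvm : |v j| = m := by
    refine le_antisymm hv1 ?_
    calc m = _ := hBm.symm
      _ ≤ _ := mul_le_of_le_one_left (abs_nonneg _) hB1
  refine ⟨hvm, ?_⟩
  rw [hvm] at hBm
  exact mul_right_cancel₀ hm.ne' (by rw [hBm, one_mul])

/-- For a kernel vector, maximality of `|v|` passes along positive rates, hence to every type; then
every `ψ_i(p)` is `0` and every possible jump has Laplace transform `1`, against nonconstancy. -/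
theorem isUnit_bernstein (hirr : χ.IsIrreducible) (hnc : χ.PositionNonconstant) {p : ℝ}
    (hp : 0 < p) : IsUnit (χ.bernstein p) := by
  rw [Matrix.isUnit_iff_isUnit_det, isUnit_iff_ne_zero]
  intro hdet
  obtain ⟨v, hv0, hv⟩ := Matrix.exists_mulVec_eq_zero_iff.2 hdet
  obtain ⟨i₁, hi₁⟩ := Function.ne_iff.1 hv0
  obtain ⟨i₀, -, hi₀⟩ := Finset.exists_max_image Finset.univ (fun j => |v j|) ⟨i₁, Finset.mem_univ _⟩
  have hle : ∀ j, |v j| ≤ |v i₀| := fun j => hi₀ j (Finset.mem_univ j)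
  have hm : 0 < |v i₀| := (abs_pos.2 hi₁).trans_le (hle i₁)
  have hall : ∀ j, |v j| = |v i₀| := fun j => by
    induction hirr i₀ j with
    | refl => rfl
    | tail _ hbc ih =>
      exact ((χ.eq_of_bernstein_mulVec_eq_zero hp.le hv hm hle ih).2 _ hbc).1
  rcases hnc with ⟨i, q, -, hq⟩ | ⟨i, j, hr, hj⟩
  · exact (χ.psi_pos hp hq).ne' (χ.eq_of_bernstein_mulVec_eq_zero hp.le hv hm hle (hall i)).1
  · exact (χ.jumpLaplace_lt_one hp hj).ne
      ((χ.eq_of_bernstein_mulVec_eq_zero hp.le hv hm hle (hall i)).2 j hr).2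

end Characteristics

end MAP

/-! ### The Laplace semigroup and its forward equation -/

namespace MAP

variable {K : ℕ} {Ω : Type*} [MeasurableSpace Ω] {P : Fin K → Measure Ω}
  {ξ : ℝ≥0 → Ω → ℝ≥0∞} {J : ℝ≥0 → Ω → Option (Fin K)} {χ : Characteristics K}

/-- The exponential test function `(l, x) ↦ e^{-p x} 1_{l = j}`. -/
def expTest (p : ℝ) (j : Fin K) (l : Fin K) (x : ℝ) : ℝ :=
  (if l = j then 1 else 0) * Real.exp (-(p * x))

lemma hasDerivAt_expTest (p : ℝ) (j l : Fin K) (x : ℝ) :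
    HasDerivAt (expTest p j l) ((if l = j then 1 else 0) * (Real.exp (-(p * x)) * -p)) x := by
  have h : HasDerivAt (fun x : ℝ => -(p * x)) (-p) x := by
    simpa using ((hasDerivAt_id x).const_mul p).fun_neg
  exact h.exp.const_mul _

lemma isTestFunction_expTest {p : ℝ} (hp : 0 ≤ p) (j : Fin K) : IsTestFunction (expTest p j) := by
  intro l
  refine ⟨?_, max 1 p, fun x hx => ?_⟩
  · unfold expTest; fun_prop
  have he : Real.exp (-(p * x)) ≤ 1 := by
    rw [Real.exp_le_one_iff]
    have := mul_nonneg hp hx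
    linarith
  have he0 := Real.exp_pos (-(p * x))
  rw [(hasDerivAt_expTest p j l x).deriv, expTest]
  split_ifs
  · rw [one_mul, one_mul, abs_mul, abs_neg, abs_of_pos he0, abs_of_nonneg hp]
    exact ⟨he.trans (le_max_left _ _), (mul_le_of_le_one_left hp he).trans (le_max_right _ _)⟩
  · simp

/-- The position part of the generator acts on exponentials by scalars, so only a matrix remains.
These are the only test functions to which `HasCharacteristics` gets applied. -/
lemma generator_expTest (χ : Characteristics K) (p : ℝ) (i j : Fin K) :
    χ.generator (expTest p j) i = -χ.bernstein p i j := by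
  have h1 : ∫ x in Ioi 0, (expTest p j i x - expTest p j i 0) ∂(χ.levy i)
      = -((if i = j then 1 else 0) * ∫ x in Ioi 0, (1 - Real.exp (-(p * x))) ∂(χ.levy i)) := by
    rw [← integral_const_mul, ← integral_neg]
    congr 1
    ext x
    simp only [expTest, mul_zero, neg_zero, Real.exp_zero]
    ring
  have h2 : ∀ l, χ.rate i l * ∫ x in Ici 0, expTest p j l x ∂(χ.jump i l)
      = if l = j then χ.rate i j * χ.jumpLaplace p i j else 0 := by
    intro l
    split_ifs with h
    · subst h; simp [expTest, Characteristics.jumpLaplace]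
    · simp [expTest, h]
  rw [Characteristics.generator, h1, (hasDerivAt_expTest p j i 0).deriv,
    χ.bernstein_apply, Finset.sum_congr rfl fun l _ => h2 l]
  simp only [expTest, Finset.sum_ite_eq', Finset.mem_univ, if_true, mul_zero, neg_zero,
    Real.exp_zero]
  split_ifs
  · rw [Characteristics.psi]; ring
  · ring

/-- `laplace` with real values. -/
def laplaceReal (P : Fin K → Measure Ω) (ξ : ℝ≥0 → Ω → ℝ≥0∞) (J : ℝ≥0 → Ω → Option (Fin K))
    (k : ℕ) (t : ℝ≥0) (i j : Fin K) : ℝ :=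
  (laplace P ξ J k t i j).toReal

namespace IsNondecreasingMAP

lemma laplace_ne_top (h : IsNondecreasingMAP P ξ J) (k : ℕ) (t : ℝ≥0) (i j : Fin K) :
    laplace P ξ J k t i j ≠ ∞ :=
  ne_top_of_le_ne_top ENNReal.one_ne_top (h.laplace_le_one k t i j)

lemma laplaceReal_nonneg (k : ℕ) (t : ℝ≥0) (i j : Fin K) : 0 ≤ laplaceReal P ξ J k t i j :=
  ENNReal.toReal_nonneg

lemma laplaceReal_le_one (h : IsNondecreasingMAP P ξ J) (k : ℕ) (t : ℝ≥0) (i j : Fin K) :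
    laplaceReal P ξ J k t i j ≤ 1 :=
  ENNReal.toReal_le_of_le_ofReal zero_le_one (by simpa using h.laplace_le_one k t i j)

lemma laplaceReal_zero (h : IsNondecreasingMAP P ξ J) (k : ℕ) (i j : Fin K) :
    laplaceReal P ξ J k 0 i j = if i = j then 1 else 0 := by
  rw [laplaceReal, h.laplace_zero]
  split_ifs <;> simp

lemma laplaceReal_add (h : IsNondecreasingMAP P ξ J) (k : ℕ) (t s : ℝ≥0) (i j : Fin K) :
    laplaceReal P ξ J k (t + s) i j
      = ∑ l, laplaceReal P ξ J k t i l * laplaceReal P ξ J k s l j := by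
  simp only [laplaceReal]
  rw [h.laplace_add, ENNReal.toReal_sum fun l _ =>
    ENNReal.mul_ne_top (h.laplace_ne_top k t i l) (h.laplace_ne_top k s l j)]
  simp

lemma semigroup_expTest (h : IsNondecreasingMAP P ξ J) (k : ℕ) (t : ℝ≥0) (i j : Fin K) :
    semigroup P ξ J (expTest k j) t i = laplaceReal P ξ J k t i j := by
  rw [semigroup, Finset.sum_eq_single j]
  · rw [laplaceReal, laplace, integral_eq_lintegral_of_nonneg_ae]
    · congr 1
      refine setLIntegral_congr_fun (h.measurableSet_type t j) fun ω hω => ?_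
      have hfin : ξ t ω ≠ ∞ := fun h0 => by
        have := (h.dead_iff t ω).1 h0
        rw [mem_ofPred_eq, this] at hω
        cases hω
      simp [negExp_pow_eq_ofReal hfin, expTest]
    · exact Eventually.of_forall fun ω => by simp [expTest, Real.exp_nonneg]
    · have := h.measurable_position t
      refine Measurable.aestronglyMeasurable ?_
      unfold expTest
      fun_prop
  · intro l _ hl
    simp [expTest, hl]
  · simp

lemma tendsto_laplaceReal_slope (h : IsNondecreasingMAP P ξ J) (hχ : HasCharacteristics P ξ J χ)
    (k : ℕ) (i j : Fin K) :
    Tendsto (fun t : ℝ≥0 => (laplaceReal P ξ J k t i j - laplaceReal P ξ J k 0 i j) / (t : ℝ))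
      (𝓝[>] 0) (𝓝 (-χ.bernstein k i j)) := by
  have := hχ _ (isTestFunction_expTest (Nat.cast_nonneg k) j) i
  rw [generator_expTest] at this
  simpa [h.semigroup_expTest, h.laplaceReal_zero, expTest] using this

/-- The semigroup property, with entries in `[0, 1]`, reduces two-sided continuity at any time to
continuity at `0`. -/
lemma abs_laplaceReal_sub_le (h : IsNondecreasingMAP P ξ J) (k : ℕ) (i j : Fin K) (s t : ℝ≥0) :
    |laplaceReal P ξ J k s i j - laplaceReal P ξ J k t i j|
      ≤ ∑ l, |laplaceReal P ξ J k (nndist s t) l j - laplaceReal P ξ J k 0 l j| := by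
  have key : ∀ a b : ℝ≥0, |laplaceReal P ξ J k (a + b) i j - laplaceReal P ξ J k a i j|
      ≤ ∑ l, |laplaceReal P ξ J k b l j - laplaceReal P ξ J k 0 l j| := by
    intro a b
    have e : laplaceReal P ξ J k a i j
        = ∑ l, laplaceReal P ξ J k a i l * laplaceReal P ξ J k 0 l j := by
      rw [← h.laplaceReal_add, add_zero]
    rw [h.laplaceReal_add, e, ← Finset.sum_sub_distrib]
    refine (Finset.abs_sum_le_sum_abs _ _).trans (Finset.sum_le_sum fun l _ => ?_)
    rw [← mul_sub, abs_mul, abs_of_nonneg (laplaceReal_nonneg k a i l)]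
    exact mul_le_of_le_one_left (abs_nonneg _) (h.laplaceReal_le_one k a i l)
  rcases le_total t s with hts | hts
  · obtain ⟨b, rfl⟩ := exists_add_of_le hts
    have hb : nndist (t + b) t = b := by
      apply NNReal.eq
      rw [coe_nndist, NNReal.dist_eq]
      simp
    rw [hb]
    exact key t b
  · obtain ⟨b, rfl⟩ := exists_add_of_le hts
    have hb : nndist s (s + b) = b := by
      apply NNReal.eq
      rw [coe_nndist, NNReal.dist_eq]
      simp
    rw [hb, abs_sub_comm]
    exact key s b

lemma continuous_laplaceReal (h : IsNondecreasingMAP P ξ J) (hχ : HasCharacteristics P ξ J χ)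
    (k : ℕ) (i j : Fin K) : Continuous fun t => laplaceReal P ξ J k t i j := by
  have h0 : ∀ l, Tendsto (fun t : ℝ≥0 => laplaceReal P ξ J k t l j - laplaceReal P ξ J k 0 l j)
      (𝓝 0) (𝓝 0) := by
    intro l
    have hid : Tendsto (fun t : ℝ≥0 => (t : ℝ)) (𝓝[>] 0) (𝓝 0) := by
      have : Tendsto (fun t : ℝ≥0 => (t : ℝ)) (𝓝 0) (𝓝 ((0 : ℝ≥0) : ℝ)) :=
        NNReal.continuous_coe.tendsto 0
      exact this.mono_left nhdsWithin_le_nhds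
    have hgt := (h.tendsto_laplaceReal_slope hχ k l j).mul hid
    rw [mul_zero] at hgt
    have hgt' : Tendsto (fun t : ℝ≥0 => laplaceReal P ξ J k t l j - laplaceReal P ξ J k 0 l j)
        (𝓝[>] 0) (𝓝 0) := by
      refine hgt.congr' ?_
      filter_upwards [self_mem_nhdsWithin] with t ht
      have ht0 : (0 : ℝ≥0) < t := ht
      rw [div_mul_cancel₀]
      exact_mod_cast ht0.ne'
    have huniv : 𝓝 (0 : ℝ≥0) = pure 0 ⊔ 𝓝[>] 0 := by
      rw [sup_comm, ← nhdsNE_sup_pure]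
      congr 2
      ext t
      simp [pos_iff_ne_zero]
    rw [huniv]
    refine Tendsto.sup ?_ hgt'
    rw [tendsto_pure_left]
    intro s hs
    simpa using mem_of_mem_nhds hs
  rw [continuous_iff_continuousAt]
  intro t
  rw [ContinuousAt, tendsto_iff_dist_tendsto_zero]
  have hd : Tendsto (fun s : ℝ≥0 => nndist s t) (𝓝 t) (𝓝 0) := by
    have : Continuous fun s : ℝ≥0 => nndist s t := by fun_prop
    simpa using this.tendsto t
  have hs := tendsto_finsetSum Finset.univ fun l _ => ((h0 l).abs).comp hd
  simp only [abs_zero, Finset.sum_const_zero] at hs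
  exact squeeze_zero (fun _ => dist_nonneg) (fun s => h.abs_laplaceReal_sub_le k i j s t) hs

/-- `M_s - M_t = M_t (M_{s-t} - 1)`. Only a right derivative comes out; with continuity it suffices
for the fundamental theorem of calculus. -/
lemma hasDerivWithinAt_laplaceReal (h : IsNondecreasingMAP P ξ J)
    (hχ : HasCharacteristics P ξ J χ) (k : ℕ) (i j : Fin K) {t : ℝ} (ht : 0 ≤ t) :
    HasDerivWithinAt (fun s : ℝ => laplaceReal P ξ J k s.toNNReal i j)
      (-∑ l, laplaceReal P ξ J k t.toNNReal i l * χ.bernstein k l j) (Ioi t) t := by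
  rw [hasDerivWithinAt_iff_tendsto_slope' (by simp), ← Finset.sum_neg_distrib]
  have hd : Tendsto (fun s : ℝ => (s - t).toNNReal) (𝓝[>] t) (𝓝[>] 0) := by
    refine tendsto_nhdsWithin_iff.2 ⟨?_, ?_⟩
    · have : Continuous fun s : ℝ => (s - t).toNNReal := by fun_prop
      have h1 := this.tendsto t
      simp only [sub_self, Real.toNNReal_zero] at h1
      exact h1.mono_left nhdsWithin_le_nhds
    · filter_upwards [self_mem_nhdsWithin] with s hs
      exact Real.toNNReal_pos.2 (sub_pos.2 hs)
  have hs := tendsto_finsetSum Finset.univ fun l _ =>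
    ((h.tendsto_laplaceReal_slope hχ k l j).comp hd).const_mul (laplaceReal P ξ J k t.toNNReal i l)
  simp only [mul_neg] at hs
  refine hs.congr' ?_
  filter_upwards [self_mem_nhdsWithin] with s hs
  have hts : 0 < s - t := sub_pos.2 hs
  have e : laplaceReal P ξ J k s.toNNReal i j
      = ∑ l, laplaceReal P ξ J k t.toNNReal i l * laplaceReal P ξ J k (s - t).toNNReal l j := by
    rw [← h.laplaceReal_add, ← Real.toNNReal_add ht hts.le, add_sub_cancel]
  have e0 : laplaceReal P ξ J k t.toNNReal i j
      = ∑ l, laplaceReal P ξ J k t.toNNReal i l * laplaceReal P ξ J k 0 l j := by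
    rw [← h.laplaceReal_add, add_zero]
  rw [slope_def_field, e, e0, ← Finset.sum_sub_distrib, Finset.sum_div]
  refine Finset.sum_congr rfl fun l _ => ?_
  simp only [Function.comp_apply]
  rw [Real.coe_toNNReal _ hts.le, ← mul_sub, mul_div_assoc]

/-- Since `M' = -MΦ(k)`, a primitive of `M` is `-MΦ(k)⁻¹`. -/
lemma integral_laplaceReal (h : IsNondecreasingMAP P ξ J) (hχ : HasCharacteristics P ξ J χ)
    (k : ℕ) (hk : IsUnit (χ.bernstein k)) (i j : Fin K) {T : ℝ} (hT : 0 ≤ T) :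
    ∫ t in (0 : ℝ)..T, laplaceReal P ξ J k t.toNNReal i j
      = (χ.bernstein k)⁻¹ i j
        - ∑ l, laplaceReal P ξ J k T.toNNReal i l * (χ.bernstein k)⁻¹ l j := by
  have hc : ∀ l, Continuous fun t : ℝ => laplaceReal P ξ J k t.toNNReal i l := fun l =>
    (h.continuous_laplaceReal hχ k i l).comp continuous_real_toNNReal
  have hmul : χ.bernstein k * (χ.bernstein k)⁻¹ = 1 :=
    Matrix.mul_nonsing_inv _ ((Matrix.isUnit_iff_isUnit_det _).1 hk)
  have hft := intervalIntegral.integral_eq_sub_of_hasDeriv_right (a := 0) (b := T)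
    (f := fun t : ℝ => -∑ l, laplaceReal P ξ J k t.toNNReal i l * (χ.bernstein k)⁻¹ l j)
    (f' := fun t : ℝ => laplaceReal P ξ J k t.toNNReal i j) (continuous_finsetSum _ fun l _ => (hc l).mul_const _).neg.continuousOn ?_
    ((hc j).intervalIntegrable _ _)
  · rw [hft]
    simp [h.laplaceReal_zero]
    ring
  · intro t ht
    rw [min_eq_left hT] at ht
    have hd := (HasDerivWithinAt.fun_sum (u := Finset.univ) fun l _ =>
      (h.hasDerivWithinAt_laplaceReal hχ k i l ht.1.le).mul_const ((χ.bernstein k)⁻¹ l j)).fun_neg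
    refine hd.congr_deriv ?_
    have e : ∑ l, laplaceReal P ξ J k t.toNNReal i l * (χ.bernstein k * (χ.bernstein k)⁻¹) l j
        = laplaceReal P ξ J k t.toNNReal i j := by
      simp [hmul, Matrix.one_apply]
    rw [← e]
    simp only [Matrix.mul_apply, Finset.mul_sum, Finset.sum_mul, neg_mul, Finset.sum_neg_distrib,
      neg_neg]
    rw [Finset.sum_comm]
    simp only [mul_assoc]

end IsNondecreasingMAP

end MAP

/-! ### The potential, the limit of the inverses and the moments -/

namespace MAP

variable {K : ℕ} {Ω : Type*} [MeasurableSpace Ω] {P : Fin K → Measure Ω}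
  {ξ : ℝ≥0 → Ω → ℝ≥0∞} {J : ℝ≥0 → Ω → Option (Fin K)} {χ : Characteristics K}

namespace IsNondecreasingMAP

/-- The row sums `E_i[e^{-kξ_t}]` decrease in `t` and have bounded integrals over `[0, n]`, so they
are `O(1/n)`. -/
lemma tendsto_laplaceReal_atTop (h : IsNondecreasingMAP P ξ J) (hχ : HasCharacteristics P ξ J χ)
    {k : ℕ} (hk0 : k ≠ 0) (hk : IsUnit (χ.bernstein k)) (i j : Fin K) :
    Tendsto (fun n : ℕ => laplaceReal P ξ J k (n : ℝ).toNNReal i j) atTop (𝓝 0) := by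
  set A := (χ.bernstein k)⁻¹ with hA
  have hc : ∀ l, Continuous fun t : ℝ => laplaceReal P ξ J k t.toNNReal i l := fun l =>
    (h.continuous_laplaceReal hχ k i l).comp continuous_real_toNNReal
  have hsum : ∀ t : ℝ≥0, ∑ l, laplaceReal P ξ J k t i l
      = (∫⁻ ω, negExp (ξ t ω) ^ k ∂(P i)).toReal := fun t => by
    rw [← h.sum_laplace hk0, ENNReal.toReal_sum fun l _ => h.laplace_ne_top k t i l]
    rfl
  have hanti : ∀ s t : ℝ≥0, s ≤ t →
      ∑ l, laplaceReal P ξ J k t i l ≤ ∑ l, laplaceReal P ξ J k s i l := by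
    intro s t hst
    rw [hsum, hsum]
    refine ENNReal.toReal_mono ?_ (lintegral_mono fun ω =>
      pow_le_pow_left' (antitone_negExp (h.monotone ω hst)) k)
    rw [← h.sum_laplace hk0]
    exact ENNReal.sum_ne_top.2 fun l _ => h.laplace_ne_top k s i l
  set C : ℝ := ∑ j, (|A i j| + ∑ l, |A l j|) with hC
  have hbound : ∀ n : ℕ, laplaceReal P ξ J k (n : ℝ).toNNReal i j * n ≤ C := by
    intro n
    have hn : (0 : ℝ) ≤ n := Nat.cast_nonneg n
    calc laplaceReal P ξ J k (n : ℝ).toNNReal i j * n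
        ≤ (∑ l, laplaceReal P ξ J k (n : ℝ).toNNReal i l) * n := by
          refine mul_le_mul_of_nonneg_right ?_ hn
          exact Finset.single_le_sum (f := fun l => laplaceReal P ξ J k (n : ℝ).toNNReal i l)
            (fun l _ => laplaceReal_nonneg _ _ _ _) (Finset.mem_univ j)
      _ = ∫ _ in (0 : ℝ)..n, ∑ l, laplaceReal P ξ J k (n : ℝ).toNNReal i l := by
          simp [mul_comm]
      _ ≤ ∫ t in (0 : ℝ)..n, ∑ l, laplaceReal P ξ J k t.toNNReal i l := by
          refine intervalIntegral.integral_mono_on hn (by simp)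
            ((continuous_finsetSum _ fun l _ => hc l).intervalIntegrable _ _) fun t ht => ?_
          exact hanti _ _ (Real.toNNReal_mono ht.2)
      _ = ∑ l, ∫ t in (0 : ℝ)..n, laplaceReal P ξ J k t.toNNReal i l :=
          intervalIntegral.integral_finsetSum fun l _ => (hc l).intervalIntegrable _ _
      _ ≤ C := by
          refine Finset.sum_le_sum fun l _ => ?_
          rw [h.integral_laplaceReal hχ k hk i l hn, sub_eq_add_neg, ← Finset.sum_neg_distrib]
          refine add_le_add (le_abs_self _) (Finset.sum_le_sum fun m _ => ?_)
          refine (neg_le_abs _).trans ?_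
          rw [abs_mul, abs_of_nonneg (laplaceReal_nonneg _ _ _ _)]
          exact mul_le_of_le_one_left (abs_nonneg _) (h.laplaceReal_le_one _ _ _ _)
  refine squeeze_zero' (Eventually.of_forall fun n => laplaceReal_nonneg _ _ _ _) ?_
    (tendsto_const_div_atTop_nhds_zero_nat C)
  filter_upwards [eventually_gt_atTop 0] with n hn
  rw [le_div_iff₀ (by exact_mod_cast hn)]
  exact hbound n

lemma tendsto_integral_laplaceReal (h : IsNondecreasingMAP P ξ J)
    (hχ : HasCharacteristics P ξ J χ) {k : ℕ} (hk0 : k ≠ 0) (hk : IsUnit (χ.bernstein k))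
    (i j : Fin K) :
    Tendsto (fun n : ℕ => ∫ t in (0 : ℝ)..n, laplaceReal P ξ J k t.toNNReal i j) atTop
      (𝓝 ((χ.bernstein k)⁻¹ i j)) := by
  have hs := tendsto_finsetSum Finset.univ fun l _ =>
    (h.tendsto_laplaceReal_atTop hχ hk0 hk i l).mul_const ((χ.bernstein k)⁻¹ l j)
  simp only [zero_mul, Finset.sum_const_zero] at hs
  have := (tendsto_const_nhds (x := (χ.bernstein k)⁻¹ i j)).sub hs
  rw [sub_zero] at this
  exact this.congr fun n => (h.integral_laplaceReal hχ k hk i j (Nat.cast_nonneg n)).symm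

lemma inv_bernstein_nonneg (h : IsNondecreasingMAP P ξ J)
    (hχ : HasCharacteristics P ξ J χ) {k : ℕ} (hk0 : k ≠ 0) (hk : IsUnit (χ.bernstein k))
    (i j : Fin K) : 0 ≤ (χ.bernstein k)⁻¹ i j :=
  ge_of_tendsto' (h.tendsto_integral_laplaceReal hχ hk0 hk i j) fun n =>
    intervalIntegral.integral_nonneg (Nat.cast_nonneg n) fun _ _ => laplaceReal_nonneg _ _ _ _

/-- The potential measure of the process has Laplace transform `Φ(k)⁻¹`. -/
lemma setLIntegral_laplace (h : IsNondecreasingMAP P ξ J)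
    (hχ : HasCharacteristics P ξ J χ) {k : ℕ} (hk0 : k ≠ 0) (hk : IsUnit (χ.bernstein k))
    (i j : Fin K) :
    ∫⁻ t in Ici (0 : ℝ), laplace P ξ J k t.toNNReal i j
      = ENNReal.ofReal ((χ.bernstein k)⁻¹ i j) := by
  have hc : Continuous fun t : ℝ => laplaceReal P ξ J k t.toNNReal i j :=
    (h.continuous_laplaceReal hχ k i j).comp continuous_real_toNNReal
  have hn : ∀ n : ℕ, ∫⁻ t in Icc (0 : ℝ) n, laplace P ξ J k t.toNNReal i j
      = ENNReal.ofReal (∫ t in (0 : ℝ)..n, laplaceReal P ξ J k t.toNNReal i j) := by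
    intro n
    rw [intervalIntegral.integral_of_le (Nat.cast_nonneg n), ← integral_Icc_eq_integral_Ioc,
      ofReal_integral_eq_lintegral_ofReal (hc.integrableOn_Icc)
        (Eventually.of_forall fun _ => laplaceReal_nonneg _ _ _ _)]
    exact lintegral_congr fun t => (ENNReal.ofReal_toReal (h.laplace_ne_top _ _ _ _)).symm
  rw [← iSup_setLIntegral_Icc]
  refine tendsto_nhds_unique (tendsto_atTop_iSup fun m n hmn =>
    lintegral_mono_set (Icc_subset_Icc_right (by exact_mod_cast hmn))) ?_
  exact ((ENNReal.continuous_ofReal.tendsto _).comp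
    (h.tendsto_integral_laplaceReal hχ hk0 hk i j)).congr fun n => (hn n).symm

/-- Both sides are potentials, and `e^{-kξ_t}` decreases in `k`. -/
lemma inv_bernstein_anti (h : IsNondecreasingMAP P ξ J)
    (hχ : HasCharacteristics P ξ J χ) (hu : ∀ p : ℝ, 0 < p → IsUnit (χ.bernstein p)) {k l : ℕ}
    (hk0 : k ≠ 0) (hkl : k ≤ l) (i j : Fin K) :
    (χ.bernstein l)⁻¹ i j ≤ (χ.bernstein k)⁻¹ i j := by
  have hl0 : l ≠ 0 := by omega
  have hk := hu k (by exact_mod_cast Nat.pos_of_ne_zero hk0)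
  have hl := hu l (by exact_mod_cast Nat.pos_of_ne_zero hl0)
  rw [← ENNReal.ofReal_le_ofReal_iff (h.inv_bernstein_nonneg hχ hk0 hk i j),
    ← h.setLIntegral_laplace hχ hk0 hk, ← h.setLIntegral_laplace hχ hl0 hl]
  exact lintegral_mono fun t => laplace_anti P ξ J _ i j hkl

lemma exists_tendsto_inv_bernstein (h : IsNondecreasingMAP P ξ J)
    (hχ : HasCharacteristics P ξ J χ) (hu : ∀ p : ℝ, 0 < p → IsUnit (χ.bernstein p)) :
    ∃ L : Matrix (Fin K) (Fin K) ℝ,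
      Tendsto (fun k : ℕ => (χ.bernstein (k : ℝ))⁻¹) atTop (𝓝 L) := by
  have hex : ∀ i j, ∃ x : ℝ, Tendsto (fun k : ℕ => (χ.bernstein (k : ℝ))⁻¹ i j) atTop (𝓝 x) := by
    intro i j
    -- The sequence is started at `1` because `Φ(0)` may be singular.
    have hanti : Antitone fun k : ℕ => (χ.bernstein ((k + 1 : ℕ) : ℝ))⁻¹ i j := fun k l hkl =>
      h.inv_bernstein_anti hχ hu k.succ_ne_zero (by omega) i j
    refine ⟨_, (tendsto_add_atTop_iff_nat 1).1 (tendsto_atTop_ciInf hanti ⟨0, ?_⟩)⟩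
    rintro _ ⟨k, rfl⟩
    exact h.inv_bernstein_nonneg hχ k.succ_ne_zero
      (hu _ (by exact_mod_cast k.succ_pos)) i j
  choose L hL using hex
  exact ⟨Matrix.of L, tendsto_pi_nhds.2 fun i => tendsto_pi_nhds.2 fun j => hL i j⟩

end IsNondecreasingMAP

/-- The vector `Φ(k)⁻¹ ⋯ Φ(1)⁻¹ 1`. -/
def bernsteinVec (χ : Characteristics K) (k : ℕ) : Fin K → ℝ :=
  Matrix.mulVec (bernsteinProd χ k) fun _ => 1

lemma bernsteinVec_zero (χ : Characteristics K) : bernsteinVec χ 0 = fun _ => 1 := by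
  simp [bernsteinVec, bernsteinProd]

lemma bernsteinVec_succ (χ : Characteristics K) (k : ℕ) :
    bernsteinVec χ (k + 1) = (χ.bernstein ((k + 1 : ℕ) : ℝ))⁻¹.mulVec (bernsteinVec χ k) := by
  -- In `bernsteinProd` the index `l` is real, the list being cast; here it becomes a natural
  -- number.
  have hprod : ∀ m, bernsteinProd χ m
      = ((List.range m).map fun l : ℕ => (χ.bernstein ((m : ℝ) - (l : ℝ)))⁻¹).prod := fun m => by
    simp [bernsteinProd, List.map_flatMap]
    rw [← List.map_eq_flatMap]
  rw [bernsteinVec, bernsteinVec, hprod, hprod, List.range_succ_eq_map, List.map_cons, List.prod_cons, Matrix.mulVec_mulVec, List.map_map]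
  congr 3
  · simp
  · ext l
    simp

namespace IsNondecreasingMAP

lemma bernsteinVec_nonneg (h : IsNondecreasingMAP P ξ J) (hχ : HasCharacteristics P ξ J χ)
    (hu : ∀ p : ℝ, 0 < p → IsUnit (χ.bernstein p)) (k : ℕ) (i : Fin K) :
    0 ≤ bernsteinVec χ k i := by
  induction k generalizing i with
  | zero => simp [bernsteinVec_zero]
  | succ k ih =>
    rw [bernsteinVec_succ]
    have hk := hu ((k + 1 : ℕ) : ℝ) (by exact_mod_cast k.succ_pos)
    rw [Matrix.mulVec, dotProduct]
    exact Finset.sum_nonneg fun j _ =>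
      mul_nonneg (h.inv_bernstein_nonneg hχ (k := k + 1) k.succ_ne_zero hk i j) (ih j)

theorem moment_eq (h : IsNondecreasingMAP P ξ J) (hχ : HasCharacteristics P ξ J χ)
    (hu : ∀ p : ℝ, 0 < p → IsUnit (χ.bernstein p)) (k : ℕ) (i : Fin K) :
    moment P ξ k i = ENNReal.ofReal (k.factorial * bernsteinVec χ k i) := by
  induction k generalizing i with
  | zero =>
    have := h.prob i
    simp [moment, bernsteinVec_zero]
  | succ k ih =>
    have hk := hu ((k + 1 : ℕ) : ℝ) (by exact_mod_cast k.succ_pos)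
    have hm : ∀ j, Measurable fun t : ℝ => laplace P ξ J (k + 1) t.toNNReal i j := by
      intro j
      have hc : Continuous fun t : ℝ => laplaceReal P ξ J (k + 1) t.toNNReal i j :=
        (h.continuous_laplaceReal hχ (k + 1) i j).comp continuous_real_toNNReal
      have := hc.measurable.ennreal_ofReal
      simpa [laplaceReal, h.laplace_ne_top] using this
    have hnn : ∀ j, 0 ≤ (k.factorial : ℝ) * bernsteinVec χ k j := fun j =>
      mul_nonneg (by positivity) (h.bernsteinVec_nonneg hχ hu k j)
    have hA := h.inv_bernstein_nonneg hχ (k := k + 1) k.succ_ne_zero hk i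
    rw [h.moment_succ, lintegral_finsetSum _ fun j _ => (hm j).mul_const _]
    have e : ∀ j, ∫⁻ t in Ici (0 : ℝ), laplace P ξ J (k + 1) t.toNNReal i j * moment P ξ k j
        = ENNReal.ofReal ((χ.bernstein ((k + 1 : ℕ) : ℝ))⁻¹ i j
          * (k.factorial * bernsteinVec χ k j)) := by
      intro j
      rw [lintegral_mul_const _ (hm j), h.setLIntegral_laplace hχ k.succ_ne_zero hk, ih,
        ENNReal.ofReal_mul (hA j)]
    rw [Finset.sum_congr rfl fun j _ => e j,
      ← ENNReal.ofReal_sum_of_nonneg fun j _ => mul_nonneg (hA j) (hnn j),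
      show ((k : ℝ≥0∞) + 1) = ENNReal.ofReal ((k : ℝ) + 1) by
        rw [ENNReal.ofReal_add (by positivity) zero_le_one]; simp,
      ← ENNReal.ofReal_mul (by positivity), bernsteinVec_succ]
    congr 1
    simp only [Matrix.mulVec, dotProduct, Nat.factorial_succ, Finset.mul_sum]
    refine Finset.sum_congr rfl fun j _ => ?_
    push_cast
    ring

end IsNondecreasingMAP

end MAP

/-! ### Spectral radius and exponential moments -/

namespace MAP

section SpectralRadius

variable {A : Type*} [NormedRing A] [NormedAlgebra ℂ A]

lemma spectralRadius_smul_le {c : ℂ} (hc : c ≠ 0) (x : A) :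
    spectralRadius ℂ (c • x) ≤ ‖c‖₊ * spectralRadius ℂ x := by
  refine iSup₂_le fun k hk => ?_
  have h := spectrum.unit_smul_eq_smul (R := ℂ) x (Units.mk0 c hc)
  simp only [Units.smul_mk0] at h
  rw [h] at hk
  obtain ⟨z, hz, rfl⟩ := hk
  have e : ‖c • z‖₊ = ‖c‖₊ * ‖z‖₊ := nnnorm_smul c z
  change ((‖c • z‖₊ : ℝ≥0) : ℝ≥0∞) ≤ _
  rw [e, ENNReal.coe_mul]
  gcongr
  exact le_iSup₂ (f := fun (k : ℂ) (_ : k ∈ spectrum ℂ x) => (‖k‖₊ : ℝ≥0∞)) z hz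

variable [CompleteSpace A]

/-- Gelfand's formula: `‖xⁿ‖ ≤ rⁿ` eventually, for any `r` strictly between the spectral radius and
`1`. -/
lemma summable_norm_pow_of_spectralRadius_lt_one {x : A} (hx : spectralRadius ℂ x < 1) :
    Summable fun n : ℕ => ‖x ^ n‖ := by
  obtain ⟨r, hr, hr1⟩ := ENNReal.lt_iff_exists_nnreal_btwn.1 hx
  have hr1' : (r : ℝ) < 1 := by exact_mod_cast hr1
  refine Summable.of_norm_bounded_eventually_nat
    (summable_geometric_of_lt_one r.coe_nonneg hr1') ?_
  filter_upwards [(spectrum.pow_nnnorm_pow_one_div_tendsto_nhds_spectralRadius x).eventually_lt_const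
    hr, eventually_gt_atTop 0] with n hn hn0
  have h1 : (‖x ^ n‖₊ : ℝ≥0∞) ≤ (r : ℝ≥0∞) ^ n := by
    have := ENNReal.rpow_le_rpow hn.le (Nat.cast_nonneg (α := ℝ) n)
    rwa [← ENNReal.rpow_mul, one_div_mul_cancel (by positivity), ENNReal.rpow_one,
      ENNReal.rpow_natCast] at this
  rw [norm_norm]
  exact_mod_cast h1

/-- A single power with `‖x^{n+1}‖ ‖1‖ < 1` certifies the bound, and this condition is open in `x`.
The factor `‖1‖` stays because the norm of the unit is not assumed to be `1`. -/
lemma eventually_spectralRadius_lt_one {x : A} (hx : spectralRadius ℂ x < 1) :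
    ∀ᶠ y in 𝓝 x, spectralRadius ℂ y < 1 := by
  have h0 := ((tendsto_add_atTop_iff_nat 1).2
    (summable_norm_pow_of_spectralRadius_lt_one hx).tendsto_atTop_zero).mul_const ‖(1 : A)‖
  rw [zero_mul] at h0
  obtain ⟨n, hn⟩ := (h0.eventually_lt_const one_pos).exists
  have hc : Continuous fun y : A => ‖y ^ (n + 1)‖ * ‖(1 : A)‖ := by fun_prop
  filter_upwards [hc.continuousAt.eventually_lt_const hn] with y hy
  refine (spectrum.spectralRadius_le_pow_nnnorm_pow_one_div ℂ y n).trans_lt ?_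
  rw [← ENNReal.mul_rpow_of_nonneg _ _ (by positivity)]
  refine ENNReal.rpow_lt_one ?_ (by positivity)
  exact_mod_cast hy

end SpectralRadius

section MatrixNorm

attribute [local instance] Matrix.linftyOpNormedRing Matrix.linftyOpNormedAlgebra

variable {K : ℕ}

/-- Spectral radii are complex, the matrices real: summability of powers is carried back by this
isometry. -/
lemma norm_map_complex (M : Matrix (Fin K) (Fin K) ℝ) : ‖M.map (algebraMap ℝ ℂ)‖ = ‖M‖ := by
  simp [Matrix.linfty_opNorm_def]

/-- If a sequence of matrices has a limit whose spectral radius is less than `1`, then the powers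
of all its late terms are summable in norm. -/
lemma eventually_summable_norm_pow {M : ℕ → Matrix (Fin K) (Fin K) ℝ}
    {L : Matrix (Fin K) (Fin K) ℝ} (hM : Tendsto M atTop (𝓝 L))
    {a : ℝ} (ha : 0 < a)
    (hL : ENNReal.ofReal a < (spectralRadius ℂ (L.map (algebraMap ℝ ℂ)))⁻¹) :
    ∀ᶠ k in atTop, Summable fun n : ℕ => ‖(a • M k) ^ n‖ := by
  have hc : Continuous fun N : Matrix (Fin K) (Fin K) ℝ => (a : ℂ) • N.map (algebraMap ℝ ℂ) :=
    continuous_matrix fun i j => by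
      have hij : Continuous fun N : Matrix (Fin K) (Fin K) ℝ => N i j := continuous_apply_apply i j
      exact (Complex.continuous_ofReal.comp hij).const_smul (a : ℂ)
  have hρ : spectralRadius ℂ ((a : ℂ) • L.map (algebraMap ℝ ℂ)) < 1 := by
    refine (spectralRadius_smul_le (by exact_mod_cast ha.ne') _).trans_lt ?_
    have e : ((‖(a : ℂ)‖₊ : ℝ≥0) : ℝ≥0∞) = ENNReal.ofReal a := by
      rw [ENNReal.ofReal, ENNReal.coe_inj]
      apply NNReal.eq
      simp [ha.le]
    rw [e]
    exact ENNReal.mul_lt_of_lt_div (by rwa [one_div])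
  filter_upwards [((hc.tendsto L).comp hM).eventually (eventually_spectralRadius_lt_one hρ)]
    with k hk
  refine (summable_norm_pow_of_spectralRadius_lt_one hk).congr fun n => ?_
  rw [← norm_map_complex]
  congr 1
  have e : (a : ℂ) • (M k).map (algebraMap ℝ ℂ) = (algebraMap ℝ ℂ).mapMatrix (a • M k) := by
    ext i j; simp
  simp only [Function.comp_apply]
  rw [e, ← map_pow]
  rfl

lemma abs_mulVec_le_norm (M : Matrix (Fin K) (Fin K) ℝ) (v : Fin K → ℝ) (i : Fin K) :
    |M.mulVec v i| ≤ ‖M‖ * ‖v‖ :=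
  (norm_le_pi_norm (M.mulVec v) i).trans (Matrix.linfty_opNorm_mulVec M v)

variable {Ω : Type*} [MeasurableSpace Ω] {P : Fin K → Measure Ω}
  {ξ : ℝ≥0 → Ω → ℝ≥0∞} {J : ℝ≥0 → Ω → Option (Fin K)} {χ : Characteristics K}

namespace IsNondecreasingMAP

/-- Each further factor `Φ(m)⁻¹` with `m > k` is nonnegative and entrywise at most `Φ(k)⁻¹`. -/
lemma bernsteinVec_add_le (h : IsNondecreasingMAP P ξ J) (hχ : HasCharacteristics P ξ J χ)
    (hu : ∀ p : ℝ, 0 < p → IsUnit (χ.bernstein p)) {k : ℕ} (hk : k ≠ 0) (n : ℕ) (i : Fin K) :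
    bernsteinVec χ (k + n) i ≤ ((χ.bernstein k)⁻¹ ^ n).mulVec (bernsteinVec χ k) i := by
  induction n generalizing i with
  | zero => simp
  | succ n ih =>
    rw [← add_assoc, bernsteinVec_succ, pow_succ', ← Matrix.mulVec_mulVec]
    rw [Matrix.mulVec, dotProduct, Matrix.mulVec, dotProduct]
    refine Finset.sum_le_sum fun j _ => ?_
    refine mul_le_mul (h.inv_bernstein_anti hχ hu hk (by omega) i j) (ih j)
      (h.bernsteinVec_nonneg hχ hu _ j) ?_
    exact h.inv_bernstein_nonneg hχ hk (hu _ (by exact_mod_cast Nat.pos_of_ne_zero hk)) i j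

lemma summable_bernsteinVec (h : IsNondecreasingMAP P ξ J) (hχ : HasCharacteristics P ξ J χ)
    (hu : ∀ p : ℝ, 0 < p → IsUnit (χ.bernstein p)) {L : Matrix (Fin K) (Fin K) ℝ}
    (hL : Tendsto (fun k : ℕ => (χ.bernstein (k : ℝ))⁻¹) atTop (𝓝 L)) {a : ℝ} (ha : 0 < a)
    (haL : ENNReal.ofReal a < (spectralRadius ℂ (L.map (algebraMap ℝ ℂ)))⁻¹) (i : Fin K) :
    Summable fun n : ℕ => a ^ n * bernsteinVec χ n i := by
  obtain ⟨k, hs, hk⟩ :=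
    ((eventually_summable_norm_pow hL ha haL).and (eventually_ne_atTop 0)).exists
  rw [← summable_nat_add_iff k]
  refine Summable.of_nonneg_of_le
    (fun n => mul_nonneg (by positivity) (h.bernsteinVec_nonneg hχ hu _ i)) (fun n => ?_)
    (hs.mul_right (a ^ k * ‖bernsteinVec χ k‖))
  calc a ^ (n + k) * bernsteinVec χ (n + k) i
      ≤ a ^ (n + k) * ((χ.bernstein k)⁻¹ ^ n).mulVec (bernsteinVec χ k) i := by
        rw [add_comm n k]
        exact mul_le_mul_of_nonneg_left (h.bernsteinVec_add_le hχ hu hk n i) (by positivity)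
    _ = a ^ k * ((a • (χ.bernstein k)⁻¹) ^ n).mulVec (bernsteinVec χ k) i := by
        rw [smul_pow, Matrix.smul_mulVec, Pi.smul_apply, smul_eq_mul]
        ring
    _ ≤ a ^ k * (‖(a • (χ.bernstein k)⁻¹) ^ n‖ * ‖bernsteinVec χ k‖) :=
        mul_le_mul_of_nonneg_left ((le_abs_self _).trans (abs_mulVec_le_norm _ _ _)) (by positivity)
    _ = _ := by ring

end IsNondecreasingMAP

end MatrixNorm

lemma exp_mul_le_tsum {a : ℝ} (ha : 0 < a) (x : ℝ≥0∞) :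
    EReal.exp ((a : EReal) * (x : EReal))
      ≤ ∑' n : ℕ, ENNReal.ofReal (a ^ n / n.factorial) * x ^ n := by
  by_cases hx : x = ∞
  -- At `x = ∞` the term `n = 1` is already infinite.
  · refine le_trans ?_ (ENNReal.le_tsum 1)
    simp [hx, ENNReal.mul_top, ha]
  lift x to ℝ≥0 using hx
  have e : (a : EReal) * ((x : ℝ≥0∞) : EReal) = ((a * x : ℝ) : EReal) := by
    rw [EReal.coe_mul]; rfl
  have hx0 := x.coe_nonneg
  rw [e, EReal.exp_coe, Real.exp_eq_exp_ℝ, NormedSpace.exp_eq_tsum_div,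
    ENNReal.ofReal_tsum_of_nonneg (fun n => by positivity) (Real.summable_pow_div_factorial _)]
  refine ENNReal.tsum_le_tsum fun n => le_of_eq ?_
  rw [mul_pow, mul_div_right_comm, ENNReal.ofReal_mul (by positivity), ENNReal.ofReal_pow hx0,
    ENNReal.ofReal_coe_nnreal]

variable {K : ℕ} {Ω : Type*} [MeasurableSpace Ω] {P : Fin K → Measure Ω}
  {ξ : ℝ≥0 → Ω → ℝ≥0∞} {J : ℝ≥0 → Ω → Option (Fin K)} {χ : Characteristics K}

namespace IsNondecreasingMAP

lemma measurable_expFunctional (h : IsNondecreasingMAP P ξ J) : Measurable (expFunctional ξ) := by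
  rw [funext h.expFunctional_eq]
  exact measurable_pathFunctional.comp h.measurable_path

theorem lintegral_exp_lt_top (h : IsNondecreasingMAP P ξ J) (hχ : HasCharacteristics P ξ J χ)
    (hu : ∀ p : ℝ, 0 < p → IsUnit (χ.bernstein p)) {L : Matrix (Fin K) (Fin K) ℝ}
    (hL : Tendsto (fun k : ℕ => (χ.bernstein (k : ℝ))⁻¹) atTop (𝓝 L)) {a : ℝ}
    (haL : ENNReal.ofReal a < (spectralRadius ℂ (L.map (algebraMap ℝ ℂ)))⁻¹) (i : Fin K) :
    ∫⁻ ω, EReal.exp ((a : EReal) * (expFunctional ξ ω : EReal)) ∂(P i) < ∞ := by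
  have := h.prob i
  -- For `a ≤ 0` the exponential is at most `1`; the series argument needs nonnegative coefficients.
  rcases le_or_gt a 0 with ha | ha
  · refine (lintegral_mono fun ω => ?_).trans_lt (b := ∫⁻ _, 1 ∂(P i)) (by simp)
    rw [EReal.exp_le_one_iff]
    exact EReal.mul_nonpos_iff.2 (Or.inr ⟨by exact_mod_cast ha, EReal.coe_ennreal_nonneg _⟩)
  refine (lintegral_mono fun ω => exp_mul_le_tsum ha _).trans_lt ?_
  rw [lintegral_tsum fun n => ((h.measurable_expFunctional.pow_const n).const_mul _).aemeasurable]
  have e : ∀ n : ℕ, ∫⁻ ω, ENNReal.ofReal (a ^ n / n.factorial) * expFunctional ξ ω ^ n ∂(P i)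
      = ENNReal.ofReal (a ^ n * bernsteinVec χ n i) := by
    intro n
    have hm := h.moment_eq hχ hu n i
    rw [moment] at hm
    rw [lintegral_const_mul _ (h.measurable_expFunctional.pow_const n), hm,
      ← ENNReal.ofReal_mul (by positivity)]
    congr 1
    field_simp
  simp_rw [e]
  rw [← ENNReal.ofReal_tsum_of_nonneg
    (fun n => mul_nonneg (by positivity) (h.bernsteinVec_nonneg hχ hu n i))
    (h.summable_bernsteinVec hχ hu hL ha haL i)]
  exact ENNReal.ofReal_lt_top

end IsNondecreasingMAP

end MAP

end

theorem mainTheorem2 {K : ℕ} (χ : MAP.Characteristics K)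
    (hirr : χ.IsIrreducible) (hnc : χ.PositionNonconstant)
    {Ω : Type*} [MeasurableSpace Ω] (P : Fin K → Measure Ω)
    (ξ : ℝ≥0 → Ω → ℝ≥0∞) (J : ℝ≥0 → Ω → Option (Fin K))
    (hMAP : MAP.IsNondecreasingMAP P ξ J) (hχ : MAP.HasCharacteristics P ξ J χ) :
    (∀ p : ℝ, 0 < p → IsUnit (χ.bernstein p)) ∧
    (∀ (k : ℕ) (i : Fin K), MAP.moment P ξ k i ≠ ∞ ∧
      (MAP.moment P ξ k i).toReal
        = (k.factorial : ℝ) * (Matrix.mulVec (MAP.bernsteinProd χ k) (fun _ => 1)) i) ∧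
    ∃ L : Matrix (Fin K) (Fin K) ℝ,
      Tendsto (fun k : ℕ => (χ.bernstein (k : ℝ))⁻¹) atTop (𝓝 L) ∧
      ∀ a : ℝ, ENNReal.ofReal a < (spectralRadius ℂ (L.map (algebraMap ℝ ℂ)))⁻¹ →
        ∀ i, ∫⁻ ω, EReal.exp ((a : EReal) * (MAP.expFunctional ξ ω : EReal)) ∂(P i) < ∞ := by
  have hu : ∀ p : ℝ, 0 < p → IsUnit (χ.bernstein p) := fun p hp =>
    χ.isUnit_bernstein hirr hnc hp
  obtain ⟨L, hL⟩ := hMAP.exists_tendsto_inv_bernstein hχ hu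
  refine ⟨hu, fun k i => ?_, L, hL, fun a ha i => hMAP.lintegral_exp_lt_top hχ hu hL ha i⟩
  rw [hMAP.moment_eq hχ hu k i]
  exact ⟨ENNReal.ofReal_ne_top, ENNReal.toReal_ofReal
    (mul_nonneg (Nat.cast_nonneg _) (hMAP.bernsteinVec_nonneg hχ hu k i))⟩
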